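/- A meandric system of size $n$ is a pair of non-crossing perfect matchings of $\{1,\dots,2n\}$, drawn as arcs in the upper and in the lower half-plane respectively; its components are the closed loops formed by these arcs. The support of a loop is its set of points on the horizontal axis, and its base is the integer interval from the leftmost to the rightmost point of its support. A shape $S$ is a single non-crossing loop with support $\{1=i_1<i_2<\dots<i_{2k}=2\ell\}$, $k,\ell\ge 1$, such that every $i_{j+1}-i_j$ is odd; $\ell=\ell(S)$ is its half-length. A component of a meandric system has shape $S$ if it is a translate of $S$. The shape $S$ is strong if any two different components of shape $S$ of one meandric system have disjoint bases. The loop $S$ together with the horizontal axis divides the plane into an unbounded face $F_+$ in the upper half-plane, an unbounded face $F_-$ in the lower half-plane, and a set $\mathcal F$ of bounded faces. For a face $F$ let $v(F)$ be the number (necessarily even) of points of $\{1,\dots,2\ell\}$ that lie on the boundary of $F$ but not on $S$. Put $$K=\prod_{F\in\mathcal F}\mathrm{Cat}_{v(F)/2},\qquad c_+=\tfrac12 v(F_+),\qquad c_-=\tfrac12 v(F_-),\qquad \mathrm{Cat}_m=\frac{(2m)!}{m!\,(m+1)!}.$$ **Theorem.** Let $S$ be a strong shape, and let $X_{S,n}$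 be the number of components of shape $S$ in a uniformly random meandric system of size $n$. Then $$\frac{X_{S,n}-n\mu_S}{\sigma_S\sqrt n}\;\longrightarrow\;\mathcal N(0,1)\quad\text{in distribution as } n\to\infty,$$ where $$\mu_S=\frac{2K}{4^{2\ell-c_+-c_-}}>0\qquad\text{and}\qquad \sigma_S=\sqrt{\frac{2K}{4^{2\ell-c_+-c_-}}\Bigl(1-\frac{K(4\ell-1)}{4^{2\ell-c_+-c_-}}\Bigr)}>0 .$$ -/

import Mathlib

open Filter MeasureTheory ProbabilityTheory

/-- A non-crossing perfect matching (pair partition) of a finite set `A` of points of the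
horizontal axis, given by the map that sends a point to its partner.  It encodes a system of
non-crossing arcs with endpoints `A` drawn in one half-plane. -/
@[ext]
structure NCMatching (A : Finset ℤ) where
  partner : A → A
  partner_partner : ∀ a, partner (partner a) = a
  partner_ne : ∀ a, partner a ≠ a
  noncrossing : ∀ a b, ¬ (a < b ∧ b < partner a ∧ partner a < partner b)

noncomputable instance (A : Finset ℤ) : Fintype (NCMatching A) :=
  Fintype.ofInjective NCMatching.partner fun _ _ h => NCMatching.ext h

/-- The graph on the points `A` whose edges are the arcs of an upper and of a lower matching. -/
def arcGraph {A : Finset ℤ} (up low : NCMatching A) : SimpleGraph A where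
  Adj x y := up.partner x = y ∨ low.partner x = y
  symm := ⟨by
    rintro x y (rfl | rfl)
    · exact Or.inl (up.partner_partner x)
    · exact Or.inr (low.partner_partner x)⟩
  loopless := ⟨by
    rintro x (h | h)
    · exact up.partner_ne x h
    · exact low.partner_ne x h⟩

/-- The vertices `1, …, 2n` of a meandric system of size `n`. -/
noncomputable abbrev vertices (n : ℕ) : Finset ℤ := Finset.Icc 1 (2 * (n : ℤ))

/-- A meandric system of size `n`: a pair of non-crossing matchings of `{1, …, 2n}`, one drawn in
the upper and one in the lower half-plane. -/
@[ext]
structure MeandricSystem (n : ℕ) where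
  up : NCMatching (vertices n)
  low : NCMatching (vertices n)

noncomputable instance (n : ℕ) : Fintype (MeandricSystem n) :=
  Fintype.ofInjective (fun M => (M.up, M.low)) fun _ _ h =>
    MeandricSystem.ext (congrArg Prod.fst h) (congrArg Prod.snd h)

instance (n : ℕ) : Nonempty (NCMatching (vertices n)) :=
  ⟨{ partner := fun a => ⟨if a.1 % 2 = 1 then a.1 + 1 else a.1 - 1, by
        have := Finset.mem_Icc.1 a.2
        rw [Finset.mem_Icc]
        split_ifs <;> omega⟩
     partner_partner := by
        rintro ⟨a, ha⟩
        apply Subtype.ext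
        dsimp only
        split_ifs <;> omega
     partner_ne := by
        rintro ⟨a, ha⟩ h
        have h := congrArg Subtype.val h
        dsimp only at h
        split_ifs at h <;> omega
     noncrossing := by
        rintro ⟨a, ha⟩ ⟨b, hb⟩ ⟨h1, h2, h3⟩
        rw [Subtype.mk_lt_mk] at h1 h2 h3
        dsimp only at h1 h2 h3
        split_ifs at h1 h2 h3 <;> omega }⟩

instance (n : ℕ) : Nonempty (MeandricSystem n) :=
  ⟨⟨Classical.arbitrary _, Classical.arbitrary _⟩⟩

instance (n : ℕ) : MeasurableSpace (MeandricSystem n) := ⊤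

/-- The uniform distribution on the meandric systems of size `n`. -/
noncomputable def uniformMeandric (n : ℕ) : Measure (MeandricSystem n) :=
  (PMF.uniformOfFintype (MeandricSystem n)).toMeasure

instance (n : ℕ) : IsProbabilityMeasure (uniformMeandric n) :=
  inferInstanceAs (IsProbabilityMeasure (PMF.uniformOfFintype (MeandricSystem n)).toMeasure)

/-- The connected components (loops) of a meandric system. -/
abbrev MeandricSystem.Component {n : ℕ} (M : MeandricSystem n) : Type :=
  (arcGraph M.up M.low).ConnectedComponent

/-- A shape: a single loop, given by its upper and lower arcs, with support
`{1 = i₁ < i₂ < ⋯ < i₂ₖ = 2ℓ}`, where `ℓ ≥ 1` is the half-length, such that consecutive points of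
the support have odd differences. -/
structure Shape where
  halfLength : ℕ
  halfLength_pos : 1 ≤ halfLength
  support : Finset ℤ
  support_subset : support ⊆ Finset.Icc 1 (2 * (halfLength : ℤ))
  one_mem : 1 ∈ support
  last_mem : 2 * (halfLength : ℤ) ∈ support
  odd_gap : ∀ i ∈ support, ∀ j ∈ support, i < j → (∀ k ∈ support, ¬ (i < k ∧ k < j)) → Odd (j - i)
  up : NCMatching support
  low : NCMatching support
  connected : (arcGraph up low).Connected

/-- The component `C` of `M` has shape `S`: for some integer `t`, the translation by `t` maps the
support, the upper arcs and the lower arcs of `S` onto those of `C`. -/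
def MeandricSystem.HasShape {n : ℕ} (M : MeandricSystem n) (C : M.Component) (S : Shape) : Prop :=
  ∃ t : ℤ,
    (∀ x : ℤ, (∃ v ∈ C.supp, (v : ℤ) = x) ↔ ∃ s ∈ S.support, s + t = x) ∧
    ∀ v ∈ C.supp, ∀ s : S.support, (v : ℤ) = s + t →
      (M.up.partner v : ℤ) = S.up.partner s + t ∧ (M.low.partner v : ℤ) = S.low.partner s + t

/-- The number of components of `M` that have shape `S`. -/
noncomputable def shapeCount (S : Shape) {n : ℕ} (M : MeandricSystem n) : ℕ :=
  Nat.card {C : M.Component // M.HasShape C S}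

/-- The base of a component: the integer interval from the leftmost to the rightmost point of its
support. -/
def MeandricSystem.base {n : ℕ} (M : MeandricSystem n) (C : M.Component) : Set ℤ :=
  {x | ∃ v ∈ C.supp, ∃ w ∈ C.supp, (v : ℤ) ≤ x ∧ x ≤ (w : ℤ)}

/-- A shape `S` is strong if, in every meandric system, two different components that both have
shape `S` do not overlap, i.e. have disjoint bases. -/
def Shape.IsStrong (S : Shape) : Prop :=
  ∀ (n : ℕ) (M : MeandricSystem n) (C D : M.Component), M.HasShape C S → M.HasShape D S →
    C ≠ D → Disjoint (M.base C) (M.base D)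

/-- The arc joining `a` to its partner, with `a` as left endpoint, passes over the point `x` of the
axis (under it, for arcs in the lower half-plane). -/
def NCMatching.Covers {A : Finset ℤ} (m : NCMatching A) (a : A) (x : ℤ) : Prop :=
  (a : ℤ) < x ∧ x < (m.partner a : ℤ)

open Classical in
/-- The left endpoints of the arcs of a matching.  In the half-plane of the arcs, each arc bounds
exactly one bounded face of which it is the outer boundary, so these points label the bounded
faces. -/
noncomputable def NCMatching.leftEnds {A : Finset ℤ} (m : NCMatching A) : Finset A :=
  Finset.univ.filter fun a => a < m.partner a

namespace Shape

open Classical in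
/-- The integers of the base of `S`, not in the support of `S`, on the boundary of the bounded face
whose outer arc is the arc of `m` with left endpoint `a`: those for which that arc is the innermost
arc passing over them. -/
noncomputable def boundedFace (S : Shape) (m : NCMatching S.support) (a : S.support) : Finset ℤ :=
  (Finset.Icc 1 (2 * (S.halfLength : ℤ)) \ S.support).filter fun x =>
    m.Covers a x ∧ ∀ b, m.Covers b x → b ≤ a ∧ m.partner a ≤ m.partner b

open Classical in
/-- The integers of the base of `S`, not in the support of `S`, on the boundary of the unbounded
face of the half-plane of `m`: those over which no arc passes. -/
noncomputable def unboundedFace (S : Shape) (m : NCMatching S.support) : Finset ℤ :=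
  (Finset.Icc 1 (2 * (S.halfLength : ℤ)) \ S.support).filter fun x => ∀ a, ¬ m.Covers a x

/-- The product of the Catalan numbers of half the number of free vertices, over all the bounded
faces (of both half-planes). -/
noncomputable def K (S : Shape) : ℕ :=
  (∏ a ∈ S.up.leftEnds, catalan ((S.boundedFace S.up a).card / 2)) *
    ∏ a ∈ S.low.leftEnds, catalan ((S.boundedFace S.low a).card / 2)

/-- Half the number of free vertices on the unbounded upper face (this number is even). -/
noncomputable def cPlus (S : Shape) : ℕ := (S.unboundedFace S.up).card / 2

/-- Half the number of free vertices on the unbounded lower face (this number is even). -/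
noncomputable def cMinus (S : Shape) : ℕ := (S.unboundedFace S.low).card / 2

/-- `4 ^ (2ℓ - c₊ - c₋)`, with an integer exponent. -/
noncomputable def fourPow (S : Shape) : ℝ :=
  (4 : ℝ) ^ (2 * (S.halfLength : ℤ) - (S.cPlus : ℤ) - (S.cMinus : ℤ))

/-- `μ_S = 2K / 4 ^ (2ℓ - c₊ - c₋)`. -/
noncomputable def mean (S : Shape) : ℝ := 2 * (S.K : ℝ) / S.fourPow

/-- `σ_S = √(μ_S (1 - K (4ℓ - 1) / 4 ^ (2ℓ - c₊ - c₋)))`. -/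
noncomputable def stdDev (S : Shape) : ℝ :=
  √(2 * (S.K : ℝ) / S.fourPow *
    (1 - (S.K : ℝ) * (4 * (S.halfLength : ℝ) - 1) / S.fourPow))

end Shape

/-! The binomial moments of the count are explicit. Strength makes distinct copies of `S` occupy
disjoint windows of length 2ℓ, so summing binom(X, k) over all systems amounts to choosing k
disjoint windows, in binom(2n - (2ℓ - 1)k, k) ways, and counting the systems that contain S at each
of them. In each half-plane the prescribed arcs cut out faces, and a non-crossing completion is an
independent non-crossing matching of the free points of every face (`card_isNC_extends`). Bounded
faces contribute the factor K per copy; the unbounded face contributes Cat(n - k(ℓ - c₊)) above and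
Cat(n - k(ℓ - c₋)) below. This gives `Shape.sum_choose_shapeCount`.

Consequently the average of (1 + u)^X is the sum over k of x^k / k! times a correction b(n, k),
where x = u μ n (`Shape.sum_pow_shapeCount`). With u = exp(λ/√n) - 1 and λ ≥ 0 all terms are
nonnegative, and the sum is exp(x) times the mean of b under a Poisson law of parameter x. If λ > 0,
then x has order √n, so this law concentrates where k/√n is near ξ = μλ; there the Catalan ratios
tend to 1 and the placement ratio tends to exp(-(4ℓ - 1) ξ² / 4). Since x - λμ√n tends to μλ²/2, the
centred moment generating function tends to exp(λ² σ² / 2) for all λ ≥ 0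
(`Shape.tendsto_average_exp`).

The limit variance is nonnegative by Cauchy–Schwarz, and nonzero because 4ℓ - 1 is odd and at least
3, hence divides no power of 2.

Only λ ≥ 0 is available, so a one-sided continuity theorem finishes
(`tendsto_gaussianReal_of_tendsto_mgf`). The exponential moments force tightness, including at -∞;
every limit point has the Gaussian moment generating function on [0, ∞), and analytic continuation
to the right half-plane followed by passage to the imaginary axis identifies its characteristic
function. -/

/-! ### Non-crossing involutions and gluing of colour classes -/

/-- `f` is a non-crossing involution of `ℤ` whose set of moved points is `A`. -/
structure IsNC (A : Finset ℤ) (f : ℤ → ℤ) : Prop where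
  invol : ∀ x, f (f x) = x
  moves : ∀ x, f x ≠ x ↔ x ∈ A
  nc : ∀ a b, ¬ (a < b ∧ b < f a ∧ f a < f b)

namespace IsNC

variable {A B : Finset ℤ} {f m : ℤ → ℤ}

lemma apply_of_notMem (hf : IsNC A f) {x : ℤ} (hx : x ∉ A) : f x = x := by
  by_contra h
  exact hx ((hf.moves x).1 h)

lemma apply_ne (hf : IsNC A f) {x : ℤ} (hx : x ∈ A) : f x ≠ x := (hf.moves x).2 hx

lemma apply_mem_iff (hf : IsNC A f) {x : ℤ} : f x ∈ A ↔ x ∈ A := by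
  rw [← hf.moves, ← hf.moves, hf.invol]
  exact ne_comm

lemma apply_mem (hf : IsNC A f) {x : ℤ} (hx : x ∈ A) : f x ∈ A := hf.apply_mem_iff.2 hx

/-- An arc has either both or none of its endpoints below another arc. -/
lemma covers_iff (hf : IsNC A f) {l x : ℤ} (h1 : x ≠ l) (h2 : x ≠ f l) :
    l < x ∧ x < f l ↔ l < f x ∧ f x < f l := by
  have key : ∀ x, x ≠ l → x ≠ f l → l < x ∧ x < f l → l < f x ∧ f x < f l := by
    rintro x h1 h2 ⟨h3, h4⟩
    have e1 : f x ≠ f l := fun h => h1 (by rw [← hf.invol x, h, hf.invol])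
    have e2 : f x ≠ l := fun h => h2 (by rw [← h, hf.invol])
    constructor
    · by_contra h
      exact hf.nc (f x) l ⟨lt_of_le_of_ne (not_lt.1 h) e2, by rw [hf.invol]; exact h3,
        by rw [hf.invol]; exact h4⟩
    · by_contra h
      exact hf.nc l x ⟨h3, h4, lt_of_le_of_ne (not_lt.1 h) e1.symm⟩
  refine ⟨key x h1 h2, fun h => ?_⟩
  have := key (f x) (fun h => h2 (by rw [← h, hf.invol]))
    (fun h => h1 (by rw [← hf.invol x, h, hf.invol])) h
  rwa [hf.invol] at this

end IsNC

/-- Non-crossing matchings of `A` are the same as non-crossing involutions of `ℤ` moving `A`. -/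
noncomputable def NCMatching.equivIsNC (A : Finset ℤ) : NCMatching A ≃ {f : ℤ → ℤ // IsNC A f} where
  toFun m := ⟨fun x => if h : x ∈ A then (m.partner ⟨x, h⟩ : ℤ) else x, by
    refine ⟨fun x => ?_, fun x => ?_, fun a b => ?_⟩
    · by_cases h : x ∈ A
      · simp [h, m.partner_partner]
      · simp [h]
    · by_cases h : x ∈ A
      · simp only [h, dite_true, iff_true]
        exact fun e => m.partner_ne ⟨x, h⟩ (Subtype.ext e)
      · simp [h]
    · by_cases ha : a ∈ A <;> by_cases hb : b ∈ A <;> simp only [ha, hb, dite_true, dite_false]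
      · exact m.noncrossing ⟨a, ha⟩ ⟨b, hb⟩
      all_goals omega⟩
  invFun f :=
    { partner := fun a => ⟨f.1 a, f.2.apply_mem a.2⟩
      partner_partner := fun a => Subtype.ext (f.2.invol a)
      partner_ne := fun a h => f.2.apply_ne a.2 (congrArg Subtype.val h)
      noncrossing := fun a b => f.2.nc a b }
  left_inv m := by
    ext a
    simp
  right_inv f := by
    apply Subtype.ext
    funext x
    by_cases h : x ∈ A
    · simp [h]
    · simp [h, f.2.apply_of_notMem h]

lemma NCMatching.equivIsNC_apply {A : Finset ℤ} (m : NCMatching A) (a : A) :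
    (NCMatching.equivIsNC A m).1 a = m.partner a := by
  simp [NCMatching.equivIsNC]

instance (A : Finset ℤ) : Finite {f : ℤ → ℤ // IsNC A f} :=
  Finite.of_equiv _ (NCMatching.equivIsNC A)

/-- The number of non-crossing matchings of `A`. -/
noncomputable def ncCount (A : Finset ℤ) : ℕ := Nat.card {f : ℤ → ℤ // IsNC A f}

/-- Non-crossing matchings of the colour classes glue, if monochromatic arcs of different colours
never cross. -/
lemma isNC_glue {κ : Type*} [DecidableEq κ] {A : Finset ℤ} {c : ℤ → κ} {g : κ → ℤ → ℤ}
    (hg : ∀ q, IsNC (A.filter (c · = q)) (g q))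
    (hc : ∀ a ∈ A, ∀ b ∈ A, ∀ a' ∈ A, ∀ b' ∈ A, a < b → b < a' → a' < b' → c a = c a' →
      c b = c b' → c a = c b) :
    IsNC A (fun x => g (c x) x) ∧ ∀ x, c (g (c x) x) = c x := by
  have col : ∀ x, c (g (c x) x) = c x := fun x => by
    by_cases hx : x ∈ A
    · exact (Finset.mem_filter.1 ((hg (c x)).apply_mem (Finset.mem_filter.2 ⟨hx, rfl⟩))).2
    · rw [(hg (c x)).apply_of_notMem (fun h => hx (Finset.mem_filter.1 h).1)]
  have mov : ∀ x, g (c x) x ≠ x ↔ x ∈ A := fun x => by simp [(hg (c x)).moves x]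
  have inv : ∀ x, g (c (g (c x) x)) (g (c x) x) = x := fun x => by
    rw [col, (hg (c x)).invol]
  refine ⟨⟨inv, mov, fun a b => ?_⟩, col⟩
  rintro ⟨h1, h2, h3⟩
  have ha : a ∈ A := (mov a).1 (by omega)
  have hb : b ∈ A := (mov b).1 (by omega)
  have mem : ∀ x ∈ A, g (c x) x ∈ A := fun x hx => by
    rw [← mov, inv]
    exact ((mov x).2 hx).symm
  have hab := hc a ha b hb _ (mem a ha) _ (mem b hb) h1 h2 h3 (col a).symm (col b).symm
  rw [← hab] at h3
  exact (hg (c a)).nc a b ⟨h1, h2, h3⟩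

/-- If monochromatic arcs of different colours never cross, the monochromatic non-crossing
matchings are the families of non-crossing matchings of the colour classes. -/
theorem card_isNC_monochromatic {κ : Type*} [DecidableEq κ] (A : Finset ℤ) (c : ℤ → κ)
    (Q : Finset κ) (hQ : ∀ x ∈ A, c x ∈ Q)
    (hc : ∀ a ∈ A, ∀ b ∈ A, ∀ a' ∈ A, ∀ b' ∈ A, a < b → b < a' → a' < b' → c a = c a' →
      c b = c b' → c a = c b) :
    Nat.card {f : ℤ → ℤ // IsNC A f ∧ ∀ x, c (f x) = c x} =
      ∏ q ∈ Q, ncCount (A.filter (c · = q)) := by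
  -- A colour outside `Q` has an empty class, whose only matching is the identity; this extends the
  -- family to all colours so that `isNC_glue` applies.
  have ext : ∀ g : ((q : Q) → {f : ℤ → ℤ // IsNC (A.filter (c · = q.1)) f}),
      ∀ q, IsNC (A.filter (c · = q)) (if h : q ∈ Q then (g ⟨q, h⟩).1 else id) := by
    intro g q
    by_cases h : q ∈ Q
    · simpa only [h, dite_true] using (g ⟨q, h⟩).2
    · have : A.filter (c · = q) = ∅ :=
        Finset.filter_false_of_mem fun x hx hxq => h (hxq ▸ hQ x hx)
      simp only [h, dite_false, this]
      exact ⟨fun _ => rfl, by simp, fun a b h => by simp only [id] at h; omega⟩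
  have e : {f : ℤ → ℤ // IsNC A f ∧ ∀ x, c (f x) = c x} ≃
      ((q : Q) → {f : ℤ → ℤ // IsNC (A.filter (c · = q.1)) f}) :=
    { toFun := fun f q => ⟨fun x => if c x = q then f.1 x else x, by
        obtain ⟨f, hf, hfc⟩ := f
        refine ⟨fun x => ?_, fun x => ?_, fun a b => ?_⟩
        · by_cases h : c x = q <;> simp [h, hfc, hf.invol]
        · by_cases h : c x = q
          · simp [h, ← hf.moves]
          · simp [h]
        · by_cases ha : c a = q <;> by_cases hb : c b = q <;> simp only [ha, hb, if_true, if_false]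
          · exact hf.nc a b
          all_goals omega⟩
      invFun := fun g => ⟨_, isNC_glue (ext g) hc⟩
      left_inv := by
        rintro ⟨f, hf, hfc⟩
        apply Subtype.ext
        funext x
        by_cases h : c x ∈ Q
        · simp [h]
        · simp only [h, dite_false]
          exact (hf.apply_of_notMem fun hx => h (hQ x hx)).symm
      right_inv := by
        intro g
        funext q
        apply Subtype.ext
        funext x
        by_cases h : c x = q
        · obtain ⟨q, hq⟩ := q
          dsimp only at h
          subst h
          simp [hq]
        · simp only [h, if_false]
          exact ((g q).2.apply_of_notMem (by simp [h])).symm }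
  rw [Nat.card_congr e, Nat.card_pi]
  exact Finset.prod_coe_sort Q (fun q => ncCount (A.filter (c · = q)))

/-! ### Faces cut out by a partial matching -/

open Classical in
/-- The left endpoint of the innermost arc of `m` passing over `x`. -/
noncomputable def innermost (B : Finset ℤ) (m : ℤ → ℤ) (x : ℤ) : WithBot ℤ :=
  (B.filter fun l => l < x ∧ x < m l).max

lemma innermost_eq_bot {B : Finset ℤ} {m : ℤ → ℤ} {x : ℤ} :
    innermost B m x = ⊥ ↔ ∀ l ∈ B, ¬ (l < x ∧ x < m l) := by
  rw [innermost, Finset.max_eq_bot, Finset.filter_eq_empty_iff]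

/-- Arcs of a non-crossing matching over a common point are nested, so the innermost one is detected
by its left endpoint alone. No condition on right endpoints is needed. -/
lemma innermost_eq_coe {B : Finset ℤ} {m : ℤ → ℤ} {x l : ℤ} :
    innermost B m x = l ↔ l ∈ B ∧ (l < x ∧ x < m l) ∧ ∀ b ∈ B, b < x → x < m b → b ≤ l := by
  classical
  constructor
  · intro h
    have h1 := Finset.mem_filter.1 (Finset.mem_of_max h)
    exact ⟨h1.1, h1.2, fun b hb hb1 hb2 => Finset.le_max_of_eq (by simp [hb, hb1, hb2]) h⟩
  · rintro ⟨h1, h2, h3⟩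
    apply le_antisymm
    · rw [innermost, Finset.max_le_iff]
      intro b hb
      rw [Finset.mem_filter] at hb
      exact WithBot.coe_le_coe.2 (h3 b hb.1 hb.2.1 hb.2.2)
    · exact Finset.le_max (Finset.mem_filter.2 ⟨h1, h2⟩)

lemma innermost_congr {B : Finset ℤ} {m : ℤ → ℤ} {x y : ℤ}
    (h : ∀ l ∈ B, (l < x ∧ x < m l ↔ l < y ∧ y < m l)) : innermost B m x = innermost B m y := by
  classical
  rw [innermost, innermost, Finset.filter_congr h]

/-- The colour of a point with respect to `m`: its arc, or the face that it belongs to. -/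
noncomputable def faceColor (B : Finset ℤ) (m : ℤ → ℤ) (x : ℤ) : WithBot ℤ × Bool :=
  if x ∈ B then (((min x (m x) : ℤ) : WithBot ℤ), true) else (innermost B m x, false)

lemma faceColor_of_mem {B : Finset ℤ} {m : ℤ → ℤ} {x : ℤ} (h : x ∈ B) :
    faceColor B m x = (((min x (m x) : ℤ) : WithBot ℤ), true) := if_pos h

lemma faceColor_of_notMem {B : Finset ℤ} {m : ℤ → ℤ} {x : ℤ} (h : x ∉ B) :
    faceColor B m x = (innermost B m x, false) := if_neg h

lemma faceColor_eq_true {B : Finset ℤ} {m : ℤ → ℤ} {x : ℤ} {z : WithBot ℤ} :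
    faceColor B m x = (z, true) ↔ x ∈ B ∧ ((min x (m x) : ℤ) : WithBot ℤ) = z := by
  by_cases h : x ∈ B
  · simp only [faceColor_of_mem h, h, Prod.mk.injEq, and_true, true_and]
  · simp only [faceColor_of_notMem h, h, Prod.mk.injEq, false_and, reduceCtorEq, and_false]

lemma faceColor_eq_false {B : Finset ℤ} {m : ℤ → ℤ} {x : ℤ} {z : WithBot ℤ} :
    faceColor B m x = (z, false) ↔ x ∉ B ∧ innermost B m x = z := by
  by_cases h : x ∈ B
  · simp only [faceColor_of_mem h, h, Prod.mk.injEq, not_true, false_and, reduceCtorEq, and_false]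
  · simp only [faceColor_of_notMem h, h, Prod.mk.injEq, and_true, true_and, not_false_iff]

lemma IsNC.eq_or_eq_of_min_eq {B : Finset ℤ} {m : ℤ → ℤ} (hm : IsNC B m) {x y : ℤ}
    (h : min x (m x) = min y (m y)) : y = x ∨ y = m x := by
  rcases min_choice x (m x) with h1 | h1 <;> rcases min_choice y (m y) with h2 | h2 <;>
    rw [h1, h2] at h
  · exact Or.inl h.symm
  · exact Or.inr (by rw [h, hm.invol])
  · exact Or.inr h.symm
  · exact Or.inl (by rw [← hm.invol y, ← h, hm.invol])

/-- Two arcs of `m` do not cross, and an arc of `m` separates the points below it from the others,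
so it cannot cross a chord joining two points of one face. For two chords inside faces, the
innermost arc of either face also passes over an inner endpoint of the other chord; the left
endpoints then bound each other, and the faces coincide. -/
lemma faceColor_noncrossing {B : Finset ℤ} {m : ℤ → ℤ} (hm : IsNC B m) {a b a' b' : ℤ}
    (h1 : a < b) (h2 : b < a') (h3 : a' < b') (ha : faceColor B m a = faceColor B m a')
    (hb : faceColor B m b = faceColor B m b') : faceColor B m a = faceColor B m b := by
  have arc : ∀ x y, x ∈ B → faceColor B m x = faceColor B m y → x < y → y = m x := by
    intro x y hx h hxy
    rw [faceColor_of_mem hx, eq_comm, faceColor_eq_true] at h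
    rcases hm.eq_or_eq_of_min_eq (WithBot.coe_injective h.2.symm) with h | h
    · omega
    · exact h
  by_cases haB : a ∈ B
  · have e := arc a a' haB ha (by omega)
    by_cases hbB : b ∈ B
    · have e' := arc b b' hbB hb (by omega)
      exact absurd ⟨h1, by omega, by omega⟩ (hm.nc a b)
    · rw [faceColor_of_notMem hbB, eq_comm, faceColor_eq_false] at hb
      exfalso
      cases hI : innermost B m b with
      | bot => exact (innermost_eq_bot.1 hI a haB) ⟨h1, by omega⟩
      | coe l =>
        rw [hI] at hb
        have i1 := innermost_eq_coe.1 hI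
        have i2 := innermost_eq_coe.1 hb.2
        have := i1.2.2 a haB h1 (by omega)
        have : l ≠ a := by
          rintro rfl
          omega
        exact hm.nc a l ⟨by omega, by omega, by omega⟩
  · have haB' : a' ∉ B := by
      rw [faceColor_of_notMem haB, eq_comm, faceColor_eq_false] at ha
      exact ha.1
    by_cases hbB : b ∈ B
    · have e' := arc b b' hbB hb (by omega)
      rw [faceColor_of_notMem haB, eq_comm, faceColor_eq_false] at ha
      exfalso
      cases hI : innermost B m a with
      | bot =>
        rw [hI] at ha
        exact innermost_eq_bot.1 ha.2 b hbB ⟨h2, by omega⟩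
      | coe l =>
        rw [hI] at ha
        have i1 := innermost_eq_coe.1 hI
        have i2 := innermost_eq_coe.1 ha.2
        have := i2.2.2 b hbB h2 (by omega)
        omega
    · have hbB' : b' ∉ B := by
        rw [faceColor_of_notMem hbB, eq_comm, faceColor_eq_false] at hb
        exact hb.1
      rw [faceColor_of_notMem haB, faceColor_of_notMem hbB, Prod.mk.injEq]
      rw [faceColor_of_notMem haB, faceColor_of_notMem haB', Prod.mk.injEq] at ha
      rw [faceColor_of_notMem hbB, faceColor_of_notMem hbB', Prod.mk.injEq] at hb
      refine ⟨?_, rfl⟩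
      cases hI : innermost B m a with
      | bot =>
        cases hJ : innermost B m b with
        | bot => rfl
        | coe j =>
          have j1 := innermost_eq_coe.1 hJ
          have j2 := innermost_eq_coe.1 (hb.1.symm.trans hJ)
          exact absurd ⟨by omega, by omega⟩ (innermost_eq_bot.1 (ha.1.symm.trans hI) j j1.1)
      | coe i =>
        have i1 := innermost_eq_coe.1 hI
        have i2 := innermost_eq_coe.1 (ha.1.symm.trans hI)
        cases hJ : innermost B m b with
        | bot => exact absurd ⟨by omega, by omega⟩ (innermost_eq_bot.1 hJ i i1.1)
        | coe j =>
          have j1 := innermost_eq_coe.1 hJ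
          have j2 := innermost_eq_coe.1 (hb.1.symm.trans hJ)
          have := j1.2.2 i i1.1 (by omega) (by omega)
          have := i2.2.2 j j1.1 (by omega) (by omega)
          rw [le_antisymm ‹i ≤ j› this]

/-- The colour class of an arc consists of its two endpoints, so a colour-preserving `f` must
reproduce that arc. Conversely, no arc of an extension crosses an arc of `m`, so its two ends lie
below the same arcs. -/
lemma isNC_extends_iff {A B : Finset ℤ} {m f : ℤ → ℤ} (hm : IsNC B m) (hf : IsNC A f)
    (hBA : B ⊆ A) :
    (∀ x ∈ B, f x = m x) ↔ ∀ x, faceColor B m (f x) = faceColor B m x := by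
  constructor
  · intro h x
    by_cases hx : x ∈ B
    · have h1 : m x ∈ B := hm.apply_mem hx
      rw [h x hx, faceColor_of_mem hx, faceColor_of_mem h1, hm.invol, min_comm]
    · have h1 : f x ∉ B := fun h' => hx <| by
        rw [← hf.invol x, h _ h']
        exact hm.apply_mem h'
      rw [faceColor_of_notMem hx, faceColor_of_notMem h1, Prod.mk.injEq]
      refine ⟨innermost_congr fun l hl => ?_, rfl⟩
      rw [← h l hl]
      refine (hf.covers_iff (fun e => hx (by rw [e]; exact hl)) (fun e => hx ?_)).symm
      rw [e, h l hl]
      exact hm.apply_mem hl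
  · intro h x hx
    have := h x
    rw [faceColor_of_mem hx, faceColor_eq_true] at this
    rcases hm.eq_or_eq_of_min_eq (WithBot.coe_injective this.2.symm) with h | h
    · exact absurd h (hf.apply_ne (hBA hx))
    · exact h

lemma ncCount_pair {a b : ℤ} (h : a ≠ b) : ncCount {a, b} = 1 := by
  rw [ncCount, Nat.card_eq_one_iff_unique]
  constructor
  · constructor
    have key : ∀ f, IsNC {a, b} f → f = fun x => if x = a then b else if x = b then a else x := by
      intro f hf
      funext x
      have h1 := hf.apply_mem (x := a) (by simp)
      have h2 := hf.apply_mem (x := b) (by simp)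
      have h3 := hf.apply_ne (x := a) (by simp)
      have h4 := hf.apply_ne (x := b) (by simp)
      simp only [Finset.mem_insert, Finset.mem_singleton] at h1 h2
      split_ifs with e1 e2
      · subst e1; tauto
      · subst e2; tauto
      · exact hf.apply_of_notMem (by simp [e1, e2])
    rintro ⟨f, hf⟩ ⟨g, hg⟩
    exact Subtype.ext ((key f hf).trans (key g hg).symm)
  · refine ⟨fun x => if x = a then b else if x = b then a else x, fun x => ?_, fun x => ?_,
      fun x y => ?_⟩
    · split_ifs <;> omega
    · simp only [Finset.mem_insert, Finset.mem_singleton]; split_ifs <;> omega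
    · split_ifs <;> omega

/-- The number of non-crossing matchings that extend a given partial one is the product over the
faces of the numbers of non-crossing matchings of the free points of the face. -/
theorem card_isNC_extends {A B : Finset ℤ} {m : ℤ → ℤ} (hm : IsNC B m) (hBA : B ⊆ A) :
    Nat.card {f : ℤ → ℤ // IsNC A f ∧ ∀ x ∈ B, f x = m x} =
      ncCount ((A \ B).filter (innermost B m · = ⊥)) *
        ∏ l ∈ B.filter (fun l => l < m l), ncCount ((A \ B).filter (innermost B m · = (l : ℤ))) := by
  classical
  set L := B.filter (fun l => l < m l) with hL
  have e : Nat.card {f : ℤ → ℤ // IsNC A f ∧ ∀ x ∈ B, f x = m x} =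
      Nat.card {f : ℤ → ℤ // IsNC A f ∧ ∀ x, faceColor B m (f x) = faceColor B m x} := by
    apply Nat.card_congr
    apply Equiv.subtypeEquivRight
    intro f
    exact and_congr_right fun hf => isNC_extends_iff hm hf hBA
  have minL : ∀ x ∈ B, min x (m x) ∈ L := by
    intro x hx
    have h1 := hm.apply_ne hx
    rw [hL, Finset.mem_filter]
    rcases lt_or_gt_of_ne h1 with h | h
    · rw [min_eq_right h.le, hm.invol]
      exact ⟨hm.apply_mem hx, h⟩
    · rw [min_eq_left h.le]
      exact ⟨hx, h⟩
  have innL : ∀ x (l : ℤ), innermost B m x = l → l ∈ L := by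
    intro x l h
    have := innermost_eq_coe.1 h
    exact Finset.mem_filter.2 ⟨this.1, by omega⟩
  -- The colours are the unbounded face, one per arc and one per bounded face. Arc classes have two
  -- points and contribute a factor 1.
  rw [e, card_isNC_monochromatic A (faceColor B m)
    (insert (⊥, false) (L.image (fun l : ℤ => ((l : WithBot ℤ), true)) ∪
      L.image (fun l : ℤ => ((l : WithBot ℤ), false)))) _
    (fun a _ b _ a' _ b' _ => faceColor_noncrossing hm)]
  · have inj : ∀ q : Bool, Function.Injective (fun l : ℤ => ((l : WithBot ℤ), q)) := fun q a b h => by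
      simpa using h
    rw [Finset.prod_insert (by simp), Finset.prod_union, Finset.prod_image (inj _).injOn,
      Finset.prod_image (inj _).injOn, Finset.prod_eq_one, one_mul]
    · congr 1
      · congr 1
        ext x
        simp only [Finset.mem_filter, faceColor_eq_false, Finset.mem_sdiff]
        tauto
      · refine Finset.prod_congr rfl fun l _ => ?_
        congr 1
        ext x
        simp only [Finset.mem_filter, faceColor_eq_false, Finset.mem_sdiff]
        tauto
    · intro l hl
      have hl' := Finset.mem_filter.1 hl
      rw [← ncCount_pair (hl'.2.ne)]
      congr 1
      ext x
      simp only [Finset.mem_filter, faceColor_eq_true, Finset.mem_insert, Finset.mem_singleton,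
        WithBot.coe_inj]
      constructor
      · rintro ⟨h1, h2, h3⟩
        exact hm.eq_or_eq_of_min_eq (by rw [h3, min_eq_left hl'.2.le])
      · rintro (rfl | rfl)
        · exact ⟨hBA hl'.1, hl'.1, min_eq_left hl'.2.le⟩
        · exact ⟨hBA (hm.apply_mem hl'.1), hm.apply_mem hl'.1,
            by rw [hm.invol, min_eq_right hl'.2.le]⟩
    · rw [Finset.disjoint_left]
      simp
  · intro x hx
    simp only [Finset.mem_insert, Finset.mem_union, Finset.mem_image]
    by_cases h : x ∈ B
    · rw [faceColor_of_mem h]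
      exact Or.inr (Or.inl ⟨_, minL x h, rfl⟩)
    · rw [faceColor_of_notMem h]
      cases hI : innermost B m x with
      | bot => exact Or.inl rfl
      | coe l => exact Or.inr (Or.inr ⟨l, innL x l hI, rfl⟩)

/-! ### Catalan enumeration -/

/-- The rank of a point is a bijection from `A` to an initial segment of ℕ. This turns a sum over
the possible partners of a point into a convolution. -/
lemma Finset.sum_rank {R : Type*} [AddCommMonoid R] (A : Finset ℤ) (F : ℕ → ℕ → R) :
    ∑ b ∈ A, F (A.filter (· < b)).card (A.filter (b < ·)).card =
      ∑ i ∈ Finset.range A.card, F i (A.card - 1 - i) := by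
  have h1 : ∀ b ∈ A, (A.filter (· < b)).card + (A.filter (b < ·)).card + 1 = A.card := by
    intro b hb
    rw [← Finset.card_filter_add_card_filter_not (s := A) (· < b), add_assoc]
    congr 1
    have : A.filter (fun x => ¬ x < b) = insert b (A.filter (b < ·)) := by
      ext x
      simp only [Finset.mem_filter, Finset.mem_insert]
      constructor
      · rintro ⟨h, h'⟩
        by_cases e : x = b
        · exact Or.inl e
        · exact Or.inr ⟨h, by omega⟩
      · rintro (rfl | h)
        · exact ⟨hb, by omega⟩
        · exact ⟨h.1, by omega⟩
    rw [this, Finset.card_insert_of_notMem (by simp)]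
  have hlt : ∀ b ∈ A, ∀ c ∈ A, b < c → (A.filter (· < b)).card < (A.filter (· < c)).card := by
    intro b hb c _ hbc
    apply Finset.card_lt_card
    refine ⟨fun x hx => ?_, fun h => ?_⟩
    · simp only [Finset.mem_filter] at hx ⊢
      exact ⟨hx.1, by omega⟩
    · have := h (Finset.mem_filter.2 ⟨hb, hbc⟩)
      simp at this
  have inj : Set.InjOn (fun b => (A.filter (· < b)).card) A := by
    intro b hb c hc h
    rcases lt_trichotomy b c with h' | h' | h'
    · exact absurd h (hlt b hb c hc h').ne
    · exact h'
    · exact absurd h (hlt c hc b hb h').ne'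
  have him : A.image (fun b => (A.filter (· < b)).card) = Finset.range A.card := by
    apply Finset.eq_of_subset_of_card_le
    · intro i hi
      obtain ⟨b, hb, rfl⟩ := Finset.mem_image.1 hi
      have := h1 b hb
      rw [Finset.mem_range]
      omega
    · rw [Finset.card_image_of_injOn inj, Finset.card_range]
  rw [← him, Finset.sum_image inj]
  refine Finset.sum_congr rfl fun b hb => ?_
  congr 1
  have := h1 b hb
  omega

/-- The number of non-crossing matchings of `j` points. -/
def ncNumber (j : ℕ) : ℕ := if Even j then catalan (j / 2) else 0

lemma ncNumber_two_mul (j : ℕ) : ncNumber (2 * j) = catalan j := by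
  simp [ncNumber]

lemma ncNumber_of_even {j : ℕ} (h : Even j) : ncNumber j = catalan (j / 2) := if_pos h

/-- For even `d` only even indices survive and this is the Catalan convolution; for odd `d` one of
`i`, `d - i` is odd, so both sides vanish. -/
lemma ncNumber_add_two (d : ℕ) :
    ncNumber (d + 2) = ∑ i ∈ Finset.range (d + 1), ncNumber i * ncNumber (d - i) := by
  rcases Nat.even_or_odd d with h | h
  · obtain ⟨e, rfl⟩ := h.two_dvd
    rw [show 2 * e + 2 = 2 * (e + 1) by ring, ncNumber_two_mul, catalan_succ,
      Fin.sum_univ_eq_sum_range (fun i => catalan i * catalan (e - i))]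
    have : ∑ i ∈ Finset.range (e + 1), catalan i * catalan (e - i) =
        ∑ i ∈ (Finset.range (e + 1)).image (2 * ·), ncNumber i * ncNumber (2 * e - i) := by
      rw [Finset.sum_image (by intro a _ b _ h; simpa using h)]
      refine Finset.sum_congr rfl fun i _ => ?_
      rw [← Nat.mul_sub, ncNumber_two_mul, ncNumber_two_mul]
    rw [this]
    apply Finset.sum_subset
    · intro i hi
      obtain ⟨j, hj, rfl⟩ := Finset.mem_image.1 hi
      simp only [Finset.mem_range] at hj ⊢
      omega
    · intro i hi hi'
      have : ¬ Even i := by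
        rintro ⟨j, rfl⟩
        apply hi'
        rw [Finset.mem_image]
        simp only [Finset.mem_range] at hi ⊢
        exact ⟨j, by omega, by omega⟩
      simp [ncNumber, this]
  · rw [ncNumber, if_neg (by simpa [Nat.even_add_one, parity_simps] using h), eq_comm]
    apply Finset.sum_eq_zero
    intro i hi
    have hi := Finset.mem_range.1 hi
    by_cases h1 : Even i
    · have : ¬ Even (d - i) := by
        rw [Nat.not_even_iff_odd]
        exact Nat.Odd.sub_even (by omega) h h1
      simp [ncNumber, this]
    · simp [ncNumber, h1]

lemma isNC_swap {a b : ℤ} (h : a < b) :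
    IsNC {a, b} (fun x => if x = a then b else if x = b then a else x) := by
  refine ⟨fun x => ?_, fun x => ?_, fun x y => ?_⟩
  · split_ifs <;> omega
  · simp only [Finset.mem_insert, Finset.mem_singleton]; split_ifs <;> omega
  · split_ifs <;> omega

/-- A single prescribed arc has two faces, the outside and the region below it, and
`card_isNC_extends` gives one factor for each. -/
lemma card_isNC_apply_eq {A : Finset ℤ} {a b : ℤ} (ha : a ∈ A) (hb : b ∈ A) (hab : a < b) :
    Nat.card {f : ℤ → ℤ // IsNC A f ∧ f a = b} =
      ncCount ((A \ {a, b}).filter (fun x => ¬ (a < x ∧ x < b))) *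
        ncCount (A.filter (fun x => a < x ∧ x < b)) := by
  classical
  set m : ℤ → ℤ := fun x => if x = a then b else if x = b then a else x with hm
  have hnc : IsNC {a, b} m := isNC_swap hab
  have hma : m a = b := if_pos rfl
  have hmb : m b = a := by simp [hm, hab.ne']
  have hsub : ({a, b} : Finset ℤ) ⊆ A := by
    intro x hx
    rcases Finset.mem_insert.1 hx with rfl | hx
    · exact ha
    · rwa [Finset.mem_singleton.1 hx]
  have e : Nat.card {f : ℤ → ℤ // IsNC A f ∧ f a = b} =
      Nat.card {f : ℤ → ℤ // IsNC A f ∧ ∀ x ∈ ({a, b} : Finset ℤ), f x = m x} := by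
    refine Nat.card_congr (Equiv.subtypeEquivRight fun f => and_congr_right fun hf => ?_)
    simp only [Finset.mem_insert, Finset.mem_singleton, forall_eq_or_imp, forall_eq, hma, hmb]
    exact ⟨fun h => ⟨h, by rw [← h, hf.invol]⟩, fun h => h.1⟩
  have hL : ({a, b} : Finset ℤ).filter (fun l => l < m l) = {a} := by
    ext x
    simp only [Finset.mem_filter, Finset.mem_insert, Finset.mem_singleton]
    constructor
    · rintro ⟨h1 | h1, h⟩
      · exact h1
      · rw [h1, hmb] at h
        omega
    · intro h1
      rw [h1, hma]
      exact ⟨Or.inl rfl, hab⟩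
  rw [e, card_isNC_extends hnc hsub, hL, Finset.prod_singleton]
  congr 2
  · refine Finset.filter_congr fun x _ => ?_
    rw [innermost_eq_bot]
    simp only [Finset.mem_insert, Finset.mem_singleton, forall_eq_or_imp, forall_eq, hma, hmb]
    omega
  · ext x
    simp only [Finset.mem_filter, innermost_eq_coe, Finset.mem_sdiff, Finset.mem_insert,
      Finset.mem_singleton, forall_eq_or_imp, forall_eq, hma, hmb]
    constructor
    · rintro ⟨h1, h2, h3, h4⟩
      exact ⟨h1.1, h3⟩
    · rintro ⟨h1, h2⟩
      exact ⟨⟨h1, by omega⟩, by simp, h2, by omega, by omega⟩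

/-- The partner of the leftmost point splits the remaining points into those below its arc and those
beyond it. Strong induction turns this into the recurrence `ncNumber_add_two`. -/
theorem ncCount_eq (A : Finset ℤ) : ncCount A = ncNumber A.card := by
  classical
  induction h : A.card using Nat.strong_induction_on generalizing A with
  | _ N ih =>
  rcases A.eq_empty_or_nonempty with rfl | hne
  · rw [← h]
    have : ncNumber (∅ : Finset ℤ).card = 1 := by simp [ncNumber]
    rw [this, ncCount, Nat.card_eq_one_iff_unique]
    constructor
    · constructor
      rintro ⟨f, hf⟩ ⟨g, hg⟩
      apply Subtype.ext
      funext x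
      exact (hf.apply_of_notMem (Finset.notMem_empty x)).trans
        (hg.apply_of_notMem (Finset.notMem_empty x)).symm
    · exact ⟨⟨id, fun _ => rfl, by simp, fun a b h => by simp only [id] at h; omega⟩⟩
  set a := A.min' hne with ha
  have haA : a ∈ A := A.min'_mem hne
  have hmin : ∀ x ∈ A, a ≤ x := fun x hx => A.min'_le x hx
  set A' := A.erase a with hA'
  have hc : A'.card + 1 = N := by rw [← h, Finset.card_erase_add_one haA]
  have hgt : ∀ b, b ∈ A' ↔ b ∈ A ∧ a < b := by
    intro b
    rw [hA', Finset.mem_erase]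
    constructor
    · rintro ⟨h1, h2⟩
      have := hmin b h2
      exact ⟨h2, by omega⟩
    · rintro ⟨h1, h2⟩
      exact ⟨by omega, h1⟩
  have e : {f : ℤ → ℤ // IsNC A f} ≃ Σ b : A', {f : ℤ → ℤ // IsNC A f ∧ f a = b} :=
    { toFun := fun f => ⟨⟨f.1 a, Finset.mem_erase.2 ⟨f.2.apply_ne haA, f.2.apply_mem haA⟩⟩,
        ⟨f.1, f.2, rfl⟩⟩
      invFun := fun p => ⟨p.2.1, p.2.2.1⟩
      left_inv := fun _ => rfl
      right_inv := by
        rintro ⟨⟨b, hb⟩, ⟨f, hf, h⟩⟩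
        dsimp only at h
        subst h
        rfl }
  have fin : ∀ b : A', Finite {f : ℤ → ℤ // IsNC A f ∧ f a = b} := fun b =>
    Finite.of_injective (fun f => (⟨f.1, f.2.1⟩ : {f : ℤ → ℤ // IsNC A f}))
      fun f g h => Subtype.ext (congrArg (fun z => z.1) h)
  have step : ∀ b ∈ A', Nat.card {f : ℤ → ℤ // IsNC A f ∧ f a = b} =
      ncNumber (A'.filter (· < b)).card * ncNumber (A'.filter (b < ·)).card := by
    intro b hb
    have hb' := (hgt b).1 hb
    have s1 : (A \ {a, b}).filter (fun x => ¬ (a < x ∧ x < b)) = A'.filter (b < ·) := by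
      ext x
      simp only [Finset.mem_filter, Finset.mem_sdiff, Finset.mem_insert, Finset.mem_singleton, hgt]
      constructor
      · rintro ⟨⟨h1, h2⟩, h3⟩
        have := hmin x h1
        exact ⟨⟨h1, by omega⟩, by omega⟩
      · rintro ⟨⟨h1, h2⟩, h3⟩
        exact ⟨⟨h1, by omega⟩, by omega⟩
    have s2 : A.filter (fun x => a < x ∧ x < b) = A'.filter (· < b) := by
      ext x
      simp only [Finset.mem_filter, hgt]
      tauto
    have lt : ∀ (p : ℤ → Prop) [DecidablePred p], (A'.filter p).card < N := fun p _ => by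
      have := Finset.card_filter_le A' p
      omega
    rw [card_isNC_apply_eq haA hb'.1 hb'.2, s1, s2, ih _ (lt _) _ rfl, ih _ (lt _) _ rfl, mul_comm]
  rw [ncCount, Nat.card_congr e, Nat.card_sigma,
    Finset.sum_coe_sort A' (fun b => Nat.card {f : ℤ → ℤ // IsNC A f ∧ f a = b}),
    Finset.sum_congr rfl step, Finset.sum_rank A' (fun i j => ncNumber i * ncNumber j)]
  rcases hN : A'.card with _ | d
  · rw [hN] at hc
    rw [← hc]
    simp [ncNumber]
  · rw [hN] at hc
    rw [← hc, ncNumber_add_two]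
    simp

/-! ### Disjoint translates of a partial matching -/

section Blocks

/-- The union of the translates of `B₀` by the elements of `T`. -/
def blockSupport (B₀ T : Finset ℤ) : Finset ℤ := T.biUnion fun t => B₀.image (· + t)

lemma mem_blockSupport {B₀ T : Finset ℤ} {x : ℤ} :
    x ∈ blockSupport B₀ T ↔ ∃ t ∈ T, x - t ∈ B₀ := by
  simp only [blockSupport, Finset.mem_biUnion, Finset.mem_image]
  refine exists_congr fun t => and_congr_right fun _ => ?_
  constructor
  · rintro ⟨s, hs, rfl⟩
    simpa using hs
  · intro h
    exact ⟨_, h, by ring⟩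

open Classical in
/-- The union of the translates of the matching `m₀` of `B₀` by the elements of `T`. -/
noncomputable def blockMap (B₀ : Finset ℤ) (m₀ : ℤ → ℤ) (T : Finset ℤ) (x : ℤ) : ℤ :=
  if h : ∃ t ∈ T, x - t ∈ B₀ then m₀ (x - h.choose) + h.choose else x

variable {B₀ T A : Finset ℤ} {m₀ : ℤ → ℤ} {d : ℤ}

/-- Shifts at distance at least `d` have disjoint windows, which makes the choice in `blockMap`
immaterial. -/
lemma eq_of_mem_block (hT : ∀ t ∈ T, ∀ t' ∈ T, t < t' → t + d ≤ t') {t t' x : ℤ}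
    (ht : t ∈ T) (ht' : t' ∈ T) (h1 : x - t ∈ Finset.Icc 1 d) (h2 : x - t' ∈ Finset.Icc 1 d) :
    t = t' := by
  rw [Finset.mem_Icc] at h1 h2
  rcases lt_trichotomy t t' with h | h | h
  · have := hT t ht t' ht' h
    omega
  · exact h
  · have := hT t' ht' t ht h
    omega

lemma blockMap_add (hB : B₀ ⊆ Finset.Icc 1 d) (hT : ∀ t ∈ T, ∀ t' ∈ T, t < t' → t + d ≤ t')
    {t s : ℤ} (ht : t ∈ T) (hs : s ∈ B₀) : blockMap B₀ m₀ T (s + t) = m₀ s + t := by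
  have h : ∃ t' ∈ T, s + t - t' ∈ B₀ := ⟨t, ht, by simpa using hs⟩
  have e : h.choose = t := eq_of_mem_block hT h.choose_spec.1 ht (hB h.choose_spec.2)
    (by simpa using hB hs)
  rw [blockMap, dif_pos h, e, add_sub_cancel_right]

lemma blockMap_of_notMem {x : ℤ} (h : x ∉ blockSupport B₀ T) : blockMap B₀ m₀ T x = x := by
  rw [mem_blockSupport] at h
  rw [blockMap, dif_neg h]

lemma exists_of_mem_blockSupport {x : ℤ} (h : x ∈ blockSupport B₀ T) :
    ∃ t ∈ T, ∃ s ∈ B₀, x = s + t := by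
  obtain ⟨t, ht, h⟩ := mem_blockSupport.1 h
  exact ⟨t, ht, _, h, by ring⟩

lemma add_mem_blockSupport {t s : ℤ} (ht : t ∈ T) (hs : s ∈ B₀) : s + t ∈ blockSupport B₀ T :=
  mem_blockSupport.2 ⟨t, ht, by simpa using hs⟩

/-- Every arc stays in the window of its own translate, so two crossing arcs would belong to one
translate and would already cross in `m₀`. -/
lemma isNC_blockMap (hm : IsNC B₀ m₀) (hB : B₀ ⊆ Finset.Icc 1 d)
    (hT : ∀ t ∈ T, ∀ t' ∈ T, t < t' → t + d ≤ t') :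
    IsNC (blockSupport B₀ T) (blockMap B₀ m₀ T) := by
  have mov : ∀ x, blockMap B₀ m₀ T x ≠ x ↔ x ∈ blockSupport B₀ T := by
    intro x
    by_cases h : x ∈ blockSupport B₀ T
    · obtain ⟨t, ht, s, hs, rfl⟩ := exists_of_mem_blockSupport h
      rw [blockMap_add hB hT ht hs]
      simpa [h] using hm.apply_ne hs
    · simp [h, blockMap_of_notMem h]
  refine ⟨fun x => ?_, mov, fun a b => ?_⟩
  · by_cases h : x ∈ blockSupport B₀ T
    · obtain ⟨t, ht, s, hs, rfl⟩ := exists_of_mem_blockSupport h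
      rw [blockMap_add hB hT ht hs, blockMap_add hB hT ht (hm.apply_mem hs), hm.invol]
    · rw [blockMap_of_notMem h, blockMap_of_notMem h]
  · rintro ⟨h1, h2, h3⟩
    obtain ⟨t, ht, s, hs, rfl⟩ := exists_of_mem_blockSupport ((mov a).1 (by omega))
    obtain ⟨t', ht', s', hs', rfl⟩ := exists_of_mem_blockSupport ((mov b).1 (by omega))
    rw [blockMap_add hB hT ht hs] at h2 h3
    rw [blockMap_add hB hT ht' hs'] at h3
    have i1 := Finset.mem_Icc.1 (hB hs)
    have i2 := Finset.mem_Icc.1 (hB (hm.apply_mem hs))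
    have : t' = t := eq_of_mem_block hT (x := s' + t') ht' ht (by simpa using hB hs')
      (Finset.mem_Icc.2 ⟨by omega, by omega⟩)
    subst this
    exact hm.nc s s' ⟨by omega, by omega, by omega⟩

lemma mem_Icc_of_covers (hm : IsNC B₀ m₀) (hB : B₀ ⊆ Finset.Icc 1 d) {a x : ℤ} (ha : a ∈ B₀)
    (h1 : a < x) (h2 : x < m₀ a) : x ∈ Finset.Icc 1 d := by
  have i1 := Finset.mem_Icc.1 (hB ha)
  have i2 := Finset.mem_Icc.1 (hB (hm.apply_mem ha))
  exact Finset.mem_Icc.2 ⟨by omega, by omega⟩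

/-- Only arcs of the translate whose window contains `x` can pass over `x`; hence bounded faces of
the union are translates of bounded faces of `m₀`. -/
lemma innermost_blockMap_eq_coe (hm : IsNC B₀ m₀) (hB : B₀ ⊆ Finset.Icc 1 d)
    (hT : ∀ t ∈ T, ∀ t' ∈ T, t < t' → t + d ≤ t') {a t x : ℤ} (ha : a ∈ B₀) (ht : t ∈ T) :
    innermost (blockSupport B₀ T) (blockMap B₀ m₀ T) x = ((a + t : ℤ) : WithBot ℤ) ↔
      innermost B₀ m₀ (x - t) = a := by
  rw [innermost_eq_coe, innermost_eq_coe, blockMap_add hB hT ht ha]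
  constructor
  · rintro ⟨-, h2, h3⟩
    refine ⟨ha, by omega, fun b hb hb1 hb2 => ?_⟩
    have := h3 (b + t) (add_mem_blockSupport ht hb) (by omega)
      (by rw [blockMap_add hB hT ht hb]; omega)
    omega
  · rintro ⟨-, h2, h3⟩
    refine ⟨add_mem_blockSupport ht ha, by omega, fun b hb hb1 hb2 => ?_⟩
    obtain ⟨t', ht', s, hs, rfl⟩ := exists_of_mem_blockSupport hb
    rw [blockMap_add hB hT ht' hs] at hb2
    have : t' = t := eq_of_mem_block hT (x := x) ht' ht
      (mem_Icc_of_covers hm hB hs (by omega) (by omega)) (mem_Icc_of_covers hm hB ha h2.1 h2.2)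
    subst this
    have := h3 s hs (by omega) (by omega)
    omega

lemma innermost_blockMap_eq_bot (hB : B₀ ⊆ Finset.Icc 1 d)
    (hT : ∀ t ∈ T, ∀ t' ∈ T, t < t' → t + d ≤ t') {x : ℤ} :
    innermost (blockSupport B₀ T) (blockMap B₀ m₀ T) x = ⊥ ↔
      ∀ t ∈ T, innermost B₀ m₀ (x - t) = ⊥ := by
  simp only [innermost_eq_bot]
  constructor
  · rintro h t ht b hb hbx
    refine h (b + t) (add_mem_blockSupport ht hb) ?_
    rw [blockMap_add hB hT ht hb]
    omega
  · rintro h b hb hbx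
    obtain ⟨t, ht, s, hs, rfl⟩ := exists_of_mem_blockSupport hb
    rw [blockMap_add hB hT ht hs] at hbx
    exact h t ht s hs (by omega)

/-- The points of `{1, …, d}` outside `B₀` that lie in the face below the arc with left endpoint
`a`, or in the unbounded face. -/
noncomputable def facePoints (B₀ : Finset ℤ) (m₀ : ℤ → ℤ) (d : ℤ) (a : WithBot ℤ) : Finset ℤ :=
  (Finset.Icc 1 d \ B₀).filter (innermost B₀ m₀ · = a)

/-- The number of non-crossing matchings of `A` that contain the translates of `m₀` by the elements
of `T`. -/
theorem card_isNC_blocks (hm : IsNC B₀ m₀) (hB : B₀ ⊆ Finset.Icc 1 d)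
    (hT : ∀ t ∈ T, ∀ t' ∈ T, t < t' → t + d ≤ t')
    (hA : ∀ t ∈ T, ∀ s ∈ Finset.Icc 1 d, s + t ∈ A) :
    Nat.card {f : ℤ → ℤ // IsNC A f ∧ ∀ t ∈ T, ∀ s ∈ B₀, f (s + t) = m₀ s + t} =
      ncNumber (A.card - T.card * (Finset.Icc 1 d \ facePoints B₀ m₀ d ⊥).card) *
        (∏ a ∈ B₀.filter (fun a => a < m₀ a), ncNumber (facePoints B₀ m₀ d a).card) ^ T.card := by
  classical
  set m := blockMap B₀ m₀ T with hmdef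
  set B := blockSupport B₀ T with hBdef
  have hmB : IsNC B m := isNC_blockMap hm hB hT
  have hBA : B ⊆ A := by
    intro x hx
    obtain ⟨t, ht, s, hs, rfl⟩ := exists_of_mem_blockSupport hx
    exact hA t ht s (hB hs)
  have e : Nat.card {f : ℤ → ℤ // IsNC A f ∧ ∀ t ∈ T, ∀ s ∈ B₀, f (s + t) = m₀ s + t} =
      Nat.card {f : ℤ → ℤ // IsNC A f ∧ ∀ x ∈ B, f x = m x} := by
    refine Nat.card_congr (Equiv.subtypeEquivRight fun f => and_congr_right fun _ => ?_)
    constructor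
    · intro h x hx
      obtain ⟨t, ht, s, hs, rfl⟩ := exists_of_mem_blockSupport hx
      rw [h t ht s hs, hmdef, blockMap_add hB hT ht hs]
    · intro h t ht s hs
      rw [h _ (add_mem_blockSupport ht hs), hmdef, blockMap_add hB hT ht hs]
  rw [e, card_isNC_extends hmB hBA]
  congr 1
  · rw [ncCount_eq]
    congr 1
    -- Each translate takes away from the unbounded face its support and the points below its arcs,
    -- that is, its window minus its own outer free points.
    have hfree : (A \ B).filter (innermost B m · = ⊥) =
        A \ blockSupport (Finset.Icc 1 d \ facePoints B₀ m₀ d ⊥) T := by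
      ext x
      simp only [Finset.mem_filter, Finset.mem_sdiff, and_assoc]
      refine and_congr_right fun _ => ?_
      rw [innermost_blockMap_eq_bot hB hT, mem_blockSupport, mem_blockSupport]
      simp only [facePoints, Finset.mem_sdiff, Finset.mem_filter]
      constructor
      · rintro ⟨h1, h2⟩ ⟨t, ht, h3, h4⟩
        exact h4 ⟨⟨h3, fun h => h1 ⟨t, ht, h⟩⟩, h2 t ht⟩
      · intro h
        refine ⟨fun ⟨t, ht, h3⟩ => h ⟨t, ht, hB h3, fun h4 => h4.1.2 h3⟩, fun t ht => ?_⟩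
        by_contra h5
        refine h ⟨t, ht, ?_, fun h4 => h5 h4.2⟩
        rw [innermost_eq_bot] at h5
        push Not at h5
        obtain ⟨l, hl, h6, h7⟩ := h5
        exact mem_Icc_of_covers hm hB hl h6 h7
    rw [hfree, Finset.card_sdiff_of_subset]
    · rw [blockSupport, Finset.card_biUnion]
      · rw [Finset.sum_congr rfl fun t _ => Finset.card_image_of_injective _ (add_left_injective t)]
        simp
      · intro t ht t' ht' hne
        rw [Function.onFun, Finset.disjoint_left]
        intro x hx hx'
        obtain ⟨s, hs, rfl⟩ := Finset.mem_image.1 hx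
        obtain ⟨s', hs', e⟩ := Finset.mem_image.1 hx'
        refine hne (eq_of_mem_block hT (x := s + t) ht ht' ?_ ?_)
        · simpa using (Finset.mem_sdiff.1 hs).1
        · rw [← e]
          simpa using (Finset.mem_sdiff.1 hs').1
    · intro x hx
      obtain ⟨t, ht, s, hs, rfl⟩ := exists_of_mem_blockSupport hx
      exact hA t ht s (Finset.mem_sdiff.1 hs).1
  -- The arcs are indexed by pairs (translate, arc of `m₀`), so the product over bounded faces
  -- becomes a power with exponent `T.card`.
  · have hL : B.filter (fun l => l < m l) =
        (T ×ˢ B₀.filter (fun a => a < m₀ a)).image (fun p => p.2 + p.1) := by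
      ext x
      simp only [Finset.mem_filter, Finset.mem_image, Finset.mem_product, Prod.exists]
      constructor
      · rintro ⟨h1, h2⟩
        obtain ⟨t, ht, s, hs, rfl⟩ := exists_of_mem_blockSupport h1
        rw [hmdef, blockMap_add hB hT ht hs] at h2
        exact ⟨t, s, ⟨ht, hs, by omega⟩, rfl⟩
      · rintro ⟨t, s, ⟨ht, hs, h⟩, rfl⟩
        refine ⟨add_mem_blockSupport ht hs, ?_⟩
        rw [hmdef, blockMap_add hB hT ht hs]
        omega
    rw [hL, Finset.prod_image, Finset.prod_product, ← Finset.prod_const]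
    · refine Finset.prod_congr rfl fun t ht => Finset.prod_congr rfl fun a ha => ?_
      have ha' := (Finset.mem_filter.1 ha).1
      rw [ncCount_eq]
      congr 1
      rw [← Finset.card_image_of_injective (facePoints B₀ m₀ d a) (add_left_injective t)]
      congr 1
      ext x
      simp only [facePoints, Finset.mem_filter, Finset.mem_sdiff, Finset.mem_image]
      rw [innermost_blockMap_eq_coe hm hB hT ha' ht]
      constructor
      · rintro ⟨⟨h1, h2⟩, h3⟩
        have h4 := (innermost_eq_coe.1 h3).2.1
        exact ⟨x - t, ⟨⟨mem_Icc_of_covers hm hB ha' h4.1 h4.2,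
          fun h => h2 (mem_blockSupport.2 ⟨t, ht, h⟩)⟩, h3⟩, by ring⟩
      · rintro ⟨s, ⟨⟨h1, h2⟩, h3⟩, rfl⟩
        refine ⟨⟨hA t ht s h1, fun h => ?_⟩, by simpa using h3⟩
        obtain ⟨t', ht', h'⟩ := mem_blockSupport.1 h
        have := eq_of_mem_block hT ht ht' (x := s + t) (by simpa using h1) (hB h')
        subst this
        exact h2 (by simpa using h')
    · rintro ⟨t, s⟩ h ⟨t', s'⟩ h' heq
      simp only [Finset.coe_product, Set.mem_prod, Finset.mem_coe, Finset.mem_filter] at h h' heq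
      have := eq_of_mem_block hT (x := s + t) h.1 h'.1 (by simpa using hB h.2.1)
        (by rw [heq]; simpa using hB h'.2.1)
      subst this
      simpa using heq

end Blocks

/-! ### Free points of a shape and their parity -/

namespace NCMatching

variable {A : Finset ℤ}

/-- The involution of `ℤ` given by a matching. -/
noncomputable def fn (m : NCMatching A) : ℤ → ℤ := (equivIsNC A m).1

lemma isNC_fn (m : NCMatching A) : IsNC A m.fn := (equivIsNC A m).2

lemma fn_coe (m : NCMatching A) (a : A) : m.fn a = m.partner a := equivIsNC_apply m a

lemma fn_of_mem (m : NCMatching A) {a : ℤ} (h : a ∈ A) : m.fn a = m.partner ⟨a, h⟩ := fn_coe m ⟨a, h⟩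

end NCMatching

namespace Shape

/-- Both ends of the base belong to the support, so a free point lies between two consecutive
support points. Their odd difference means that the gap holds an even number of free points. -/
lemma exists_gap (S : Shape) {x : ℤ} (hx : x ∈ Finset.Icc 1 (2 * (S.halfLength : ℤ)) \ S.support) :
    ∃ p ∈ S.support, ∃ q ∈ S.support, p < x ∧ x < q ∧ (∀ k ∈ S.support, k ≤ p ∨ q ≤ k) ∧
      Odd (q - p) := by
  rw [Finset.mem_sdiff, Finset.mem_Icc] at hx
  obtain ⟨⟨hx1, hx2⟩, hx3⟩ := hx
  have hx1' : 1 ≠ x := fun h => hx3 (h ▸ S.one_mem)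
  have hx2' : x ≠ 2 * (S.halfLength : ℤ) := fun h => hx3 (h ▸ S.last_mem)
  obtain ⟨p, hp, hpm⟩ := (S.support.filter (· < x)).exists_max_image id
    ⟨1, Finset.mem_filter.2 ⟨S.one_mem, by omega⟩⟩
  obtain ⟨q, hq, hqm⟩ := (S.support.filter (x < ·)).exists_min_image id
    ⟨_, Finset.mem_filter.2 ⟨S.last_mem, by omega⟩⟩
  rw [Finset.mem_filter] at hp hq
  have gap : ∀ k ∈ S.support, k ≤ p ∨ q ≤ k := by
    intro k hk
    rcases lt_trichotomy k x with h | h | h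
    · exact Or.inl (hpm k (Finset.mem_filter.2 ⟨hk, h⟩))
    · exact absurd (h ▸ hk) hx3
    · exact Or.inr (hqm k (Finset.mem_filter.2 ⟨hk, h⟩))
  refine ⟨p, hp.1, q, hq.1, hp.2, hq.2, gap, S.odd_gap p hp.1 q hq.1 (by omega) fun k hk h => ?_⟩
  have := gap k hk
  omega

/-- A set of free points that with a free point contains its free neighbours has even size. -/
lemma even_card_of_closed (S : Shape) (F : Finset ℤ)
    (hF : F ⊆ Finset.Icc 1 (2 * (S.halfLength : ℤ)) \ S.support)
    (hcl : ∀ x, x ∉ S.support → x + 1 ∉ S.support → (x ∈ F ↔ x + 1 ∈ F)) : Even F.card := by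
  classical
  -- Within each gap the free points are paired as p+1 with p+2, p+3 with p+4, and so on; `P` marks
  -- the left member of a pair and `g` exchanges the two. A fixed-point-free involution of `F` then
  -- makes its size vanish modulo 2.
  let P : ℤ → Prop := fun x => ∃ p ∈ S.support, p < x ∧ Odd (x - p) ∧
    ∀ k ∈ S.support, ¬ (p < k ∧ k < x)
  let g : ℤ → ℤ := fun x => if P x then x + 1 else x - 1
  have key : ∀ x ∈ F, g x ∈ F ∧ g (g x) = x := by
    intro x hx
    obtain ⟨p, hp, q, hq, h1, h2, gap, hodd⟩ := S.exists_gap (hF hx)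
    have hPy : ∀ y, p < y → y < q → (P y ↔ Odd (y - p)) := by
      intro y hy1 hy2
      constructor
      · rintro ⟨p', hp', h3, h4, h5⟩
        have h6 := gap p' hp'
        have h7 := h5 p hp
        rwa [show p = p' by omega]
      · intro h
        refine ⟨p, hp, hy1, h, fun k hk hk' => ?_⟩
        have := gap k hk
        omega
    have hxs : ∀ y, p < y → y < q → y ∉ S.support := by
      intro y hy1 hy2 hy
      have := gap y hy
      omega
    by_cases hx' : Odd (x - p)
    · have hg : g x = x + 1 := if_pos ((hPy x h1 h2).2 hx')
      have hq' : x + 1 < q := by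
        rcases hx' with ⟨a, ha⟩
        rcases hodd with ⟨b, hb⟩
        omega
      have hn : ¬ P (x + 1) := by
        rw [hPy _ (by omega) hq']
        rcases hx' with ⟨a, ha⟩
        rintro ⟨b, hb⟩
        omega
      rw [hg]
      refine ⟨(hcl x (hxs x h1 h2) (hxs _ (by omega) hq')).1 hx, ?_⟩
      show (if P (x + 1) then x + 1 + 1 else x + 1 - 1) = x
      rw [if_neg hn]
      ring
    · have hg : g x = x - 1 := if_neg fun h => hx' ((hPy x h1 h2).1 h)
      have hp' : p < x - 1 := by
        by_contra h
        exact hx' ⟨0, by omega⟩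
      have hn : P (x - 1) := by
        rw [hPy _ hp' (by omega)]
        rw [Int.not_odd_iff_even] at hx'
        rcases hx' with ⟨a, ha⟩
        exact ⟨a - 1, by omega⟩
      rw [hg]
      refine ⟨(hcl (x - 1) (hxs _ hp' (by omega)) (by simpa using hxs x h1 h2)).2 (by simpa using hx),
        ?_⟩
      show (if P (x - 1) then x - 1 + 1 else x - 1 - 1) = x
      rw [if_pos hn]
      ring
  have hsum : ∑ x ∈ F, (1 : ZMod 2) = 0 := by
    refine Finset.sum_involution (fun x _ => g x) (fun x _ => by decide) (fun x _ _ => ?_)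
      (fun x hx => (key x hx).1) (fun x hx => (key x hx).2)
    show (if P x then x + 1 else x - 1) ≠ x
    split_ifs <;> omega
  rw [Finset.sum_const, nsmul_eq_mul, mul_one] at hsum
  exact (ZMod.natCast_eq_zero_iff_even).1 hsum

variable (S : Shape) (m : NCMatching S.support)

/-- Adjacent free points lie below the same arcs, since arcs end only at support points; so
`even_card_of_closed` applies to every face. -/
lemma even_card_facePoints (a : WithBot ℤ) :
    Even (facePoints S.support m.fn (2 * (S.halfLength : ℤ)) a).card := by
  apply S.even_card_of_closed
  · exact Finset.filter_subset _ _
  · intro x hx hx1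
    have e : innermost S.support m.fn x = innermost S.support m.fn (x + 1) := by
      refine innermost_congr fun l hl => ?_
      have h1 : l ≠ x := fun h => hx (h ▸ hl)
      have h2 : m.fn l ≠ x + 1 := fun h => hx1 (h ▸ m.isNC_fn.apply_mem hl)
      omega
    simp only [facePoints, Finset.mem_filter, Finset.mem_sdiff, hx, hx1, not_false_iff, and_true, e,
      and_congr_left_iff, Finset.mem_Icc]
    intro _
    have h1 : x ≠ 2 * (S.halfLength : ℤ) := fun h => hx (h ▸ S.last_mem)
    have h2 : x + 1 ≠ 1 := fun h => hx1 (h.symm ▸ S.one_mem)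
    omega

lemma unboundedFace_eq :
    S.unboundedFace m = facePoints S.support m.fn (2 * (S.halfLength : ℤ)) ⊥ := by
  classical
  rw [unboundedFace, facePoints]
  refine Finset.filter_congr fun x _ => ?_
  rw [innermost_eq_bot]
  constructor
  · intro h l hl
    rw [m.fn_of_mem hl]
    exact h ⟨l, hl⟩
  · rintro h ⟨a, ha⟩
    have := h a ha
    rwa [m.fn_of_mem ha] at this

/-- For arcs over a common point, the order of the left endpoints determines that of the right
endpoints by non-crossing, so the second inequality in the definition of the face is automatic. -/
lemma boundedFace_eq (a : S.support) :
    S.boundedFace m a = facePoints S.support m.fn (2 * (S.halfLength : ℤ)) (a : ℤ) := by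
  classical
  rw [boundedFace, facePoints]
  refine Finset.filter_congr fun x _ => ?_
  rw [innermost_eq_coe]
  constructor
  · rintro ⟨⟨h1, h2⟩, h3⟩
    refine ⟨a.2, ⟨h1, by rwa [m.fn_coe]⟩, fun b hb hb1 hb2 => ?_⟩
    rw [m.fn_of_mem hb] at hb2
    exact (h3 ⟨b, hb⟩ ⟨hb1, hb2⟩).1
  · rintro ⟨-, ⟨h1, h2⟩, h3⟩
    rw [m.fn_coe] at h2
    refine ⟨⟨h1, h2⟩, fun b ⟨hb1, hb2⟩ => ?_⟩
    have hba : b ≤ a := h3 b b.2 hb1 (by rwa [m.fn_coe])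
    refine ⟨hba, ?_⟩
    rcases hba.eq_or_lt with rfl | hlt
    · exact le_rfl
    · by_contra h
      exact m.noncrossing b a ⟨hlt, show (a : ℤ) < m.partner b by omega, not_le.1 h⟩

lemma prod_boundedFace :
    ∏ a ∈ m.leftEnds, catalan ((S.boundedFace m a).card / 2) =
      ∏ a ∈ S.support.filter (fun a => a < m.fn a),
        ncNumber (facePoints S.support m.fn (2 * (S.halfLength : ℤ)) a).card := by
  classical
  refine Finset.prod_bij (fun a _ => a.1) ?_ (fun a _ b _ h => Subtype.ext h) ?_ ?_
  · intro a ha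
    rw [Finset.mem_filter, m.fn_coe]
    exact ⟨a.2, (Finset.mem_filter.1 ha).2⟩
  · intro a ha
    rw [Finset.mem_filter] at ha
    refine ⟨⟨a, ha.1⟩, Finset.mem_filter.2 ⟨Finset.mem_univ _, ?_⟩, rfl⟩
    rw [m.fn_of_mem ha.1] at ha
    exact ha.2
  · intro a _
    rw [ncNumber_of_even (S.even_card_facePoints m _), boundedFace_eq]

lemma two_mul_card_unboundedFace :
    2 * ((S.unboundedFace m).card / 2) = (S.unboundedFace m).card := by
  rw [unboundedFace_eq]
  exact Nat.two_mul_div_two_of_even (S.even_card_facePoints m _)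

/-- Free points avoid both ends of the base. The bound ensures that the truncated differences
`upDrop` and `lowDrop` are the true values ℓ - c₊ and ℓ - c₋. -/
lemma card_unboundedFace_lt : (S.unboundedFace m).card / 2 < S.halfLength := by
  have h : S.unboundedFace m ⊆ Finset.Ioo 1 (2 * (S.halfLength : ℤ)) := by
    classical
    intro x hx
    have hx := (Finset.mem_filter.1 hx).1
    rw [Finset.mem_sdiff, Finset.mem_Icc] at hx
    have h1 : x ≠ 2 * (S.halfLength : ℤ) := fun h => hx.2 (h ▸ S.last_mem)
    have h2 : x ≠ 1 := fun h => hx.2 (h ▸ S.one_mem)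
    rw [Finset.mem_Ioo]
    omega
  have := Finset.card_le_card h
  rw [Int.card_Ioo] at this
  have := S.halfLength_pos
  omega

/-- The number of non-crossing matchings of `{1, …, 2n}` that contain prescribed translates of a
matching of the support of `S`. -/
theorem card_matching_blocks (n : ℕ) (T : Finset ℤ)
    (hT : ∀ t ∈ T, ∀ t' ∈ T, t < t' → t + 2 * (S.halfLength : ℤ) ≤ t')
    (hT' : ∀ t ∈ T, 0 ≤ t ∧ t + 2 * (S.halfLength : ℤ) ≤ 2 * n) :
    Nat.card {f : NCMatching (vertices n) //
        ∀ t ∈ T, ∀ s ∈ S.support, f.fn (s + t) = m.fn s + t} =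
      catalan (n - T.card * (S.halfLength - (S.unboundedFace m).card / 2)) *
        (∏ a ∈ m.leftEnds, catalan ((S.boundedFace m a).card / 2)) ^ T.card := by
  have hA : ∀ t ∈ T, ∀ s ∈ Finset.Icc 1 (2 * (S.halfLength : ℤ)), s + t ∈ vertices n := by
    intro t ht s hs
    rw [Finset.mem_Icc] at hs ⊢
    have := hT' t ht
    omega
  have e : {f : NCMatching (vertices n) // ∀ t ∈ T, ∀ s ∈ S.support, f.fn (s + t) = m.fn s + t} ≃
      {f : ℤ → ℤ // IsNC (vertices n) f ∧ ∀ t ∈ T, ∀ s ∈ S.support, f (s + t) = m.fn s + t} :=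
    ((NCMatching.equivIsNC (vertices n)).subtypeEquiv (q := fun f => ∀ t ∈ T, ∀ s ∈ S.support,
      f.1 (s + t) = m.fn s + t) (fun f => Iff.rfl)).trans
      (Equiv.subtypeSubtypeEquivSubtypeInter _
        (fun f : ℤ → ℤ => ∀ t ∈ T, ∀ s ∈ S.support, f (s + t) = m.fn s + t))
  rw [Nat.card_congr e, card_isNC_blocks m.isNC_fn S.support_subset hT hA, prod_boundedFace]
  congr 1
  have h1 : (vertices n).card = 2 * n := by simp; omega
  have h2 : (Finset.Icc 1 (2 * (S.halfLength : ℤ)) \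
      facePoints S.support m.fn (2 * (S.halfLength : ℤ)) ⊥).card =
      2 * (S.halfLength - (S.unboundedFace m).card / 2) := by
    have hsub : facePoints S.support m.fn (2 * (S.halfLength : ℤ)) ⊥ ⊆
        Finset.Icc 1 (2 * (S.halfLength : ℤ)) :=
      (Finset.filter_subset _ _).trans Finset.sdiff_subset
    rw [Finset.card_sdiff_of_subset hsub,
      ← unboundedFace_eq, Int.card_Icc, Nat.mul_sub, two_mul_card_unboundedFace]
    congr 1
    omega
  rw [h1, h2, ← ncNumber_two_mul]
  congr 1
  rw [Nat.mul_sub 2 n, mul_left_comm]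

end Shape

/-! ### Components of a given shape as occurrences at integer shifts -/

namespace MeandricSystem

variable {n : ℕ} (M : MeandricSystem n) (S : Shape)

/-- `M` contains the translate of `S` by `t`. -/
def Occurs (t : ℤ) : Prop :=
  ∀ s ∈ S.support, M.up.fn (s + t) = S.up.fn s + t ∧ M.low.fn (s + t) = S.low.fn s + t

variable {M S}

/-- The involution of `S` moves `s`, so that of `M` moves `s + t`, and only vertices are moved. An
occurrence therefore fits in the system without any assumption on `t`. -/
lemma Occurs.mem_vertices {t s : ℤ} (h : M.Occurs S t) (hs : s ∈ S.support) :
    s + t ∈ vertices n := by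
  rw [← M.up.isNC_fn.moves, (h s hs).1]
  have := S.up.isNC_fn.apply_ne hs
  omega

lemma Occurs.bounds {t : ℤ} (h : M.Occurs S t) : 0 ≤ t ∧ t + 2 * (S.halfLength : ℤ) ≤ 2 * n := by
  have h1 := Finset.mem_Icc.1 (h.mem_vertices S.one_mem)
  have h2 := Finset.mem_Icc.1 (h.mem_vertices S.last_mem)
  omega

/-- The component of `M` at an occurrence of `S`. -/
noncomputable def Occurs.component {t : ℤ} (h : M.Occurs S t) : M.Component :=
  (arcGraph M.up M.low).connectedComponentMk ⟨1 + t, h.mem_vertices S.one_mem⟩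

/-- Both arcs at a point of the translate stay in the translate, so no walk leaves it; conversely,
translation is a graph homomorphism and carries the connectedness of `S` into `M`. -/
lemma Occurs.mem_supp_iff {t : ℤ} (h : M.Occurs S t) (v : vertices n) :
    v ∈ h.component.supp ↔ ∃ s ∈ S.support, (v : ℤ) = s + t := by
  rw [SimpleGraph.ConnectedComponent.mem_supp_iff, Occurs.component,
    SimpleGraph.ConnectedComponent.eq]
  constructor
  · intro hr
    have key : ∀ u w : vertices n, (arcGraph M.up M.low).Reachable u w →
        (∃ s ∈ S.support, (w : ℤ) = s + t) → ∃ s ∈ S.support, (u : ℤ) = s + t := by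
      rintro u w ⟨p⟩
      induction p with
      | nil => exact id
      | cons hadj _ ih =>
        intro hw
        obtain ⟨s, hs, e⟩ := ih hw
        rcases hadj.symm with h' | h'
        · refine ⟨S.up.fn s, S.up.isNC_fn.apply_mem hs, ?_⟩
          rw [← h', ← M.up.fn_coe, e, (h s hs).1]
        · refine ⟨S.low.fn s, S.low.isNC_fn.apply_mem hs, ?_⟩
          rw [← h', ← M.low.fn_coe, e, (h s hs).2]
    exact key _ _ hr ⟨1, S.one_mem, rfl⟩
  · rintro ⟨s, hs, e⟩
    let φ : arcGraph S.up S.low →g arcGraph M.up M.low :=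
      { toFun := fun s => ⟨s + t, h.mem_vertices s.2⟩
        map_rel' := by
          rintro a b (rfl | rfl)
          · left
            apply Subtype.ext
            rw [← M.up.fn_coe]
            simp only [(h a a.2).1, S.up.fn_coe]
          · right
            apply Subtype.ext
            rw [← M.low.fn_coe]
            simp only [(h a a.2).2, S.low.fn_coe] }
    have := (S.connected.preconnected ⟨s, hs⟩ ⟨1, S.one_mem⟩).map φ
    convert this using 1
    · exact Subtype.ext e
    · rfl

lemma Occurs.hasShape {t : ℤ} (h : M.Occurs S t) : M.HasShape h.component S := by
  refine ⟨t, fun x => ?_, fun v _ s e => ?_⟩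
  · constructor
    · rintro ⟨v, hv, rfl⟩
      obtain ⟨s, hs, e⟩ := (h.mem_supp_iff v).1 hv
      exact ⟨s, hs, e.symm⟩
    · rintro ⟨s, hs, rfl⟩
      exact ⟨⟨s + t, h.mem_vertices hs⟩, (h.mem_supp_iff _).2 ⟨s, hs, rfl⟩, rfl⟩
  · rw [← M.up.fn_coe, ← M.low.fn_coe, ← S.up.fn_coe, ← S.low.fn_coe, e]
    exact h s s.2

lemma exists_occurs_of_hasShape {C : M.Component} (hC : M.HasShape C S) :
    ∃ (t : ℤ) (h : M.Occurs S t), h.component = C := by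
  obtain ⟨t, h1, h2⟩ := hC
  have h : M.Occurs S t := by
    intro s hs
    obtain ⟨v, hv, e⟩ := (h1 (s + t)).2 ⟨s, hs, rfl⟩
    have := h2 v hv ⟨s, hs⟩ e
    rw [← M.up.fn_coe, ← M.low.fn_coe, ← S.up.fn_coe, ← S.low.fn_coe, e] at this
    exact this
  refine ⟨t, h, ?_⟩
  obtain ⟨v, hv, e⟩ := (h1 (1 + t)).2 ⟨1, S.one_mem, rfl⟩
  rw [SimpleGraph.ConnectedComponent.mem_supp_iff] at hv
  rw [← hv, Occurs.component]
  congr 1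
  exact Subtype.ext e.symm

lemma Occurs.mem_base {t x : ℤ} (h : M.Occurs S t) (h1 : 1 + t ≤ x)
    (h2 : x ≤ 2 * (S.halfLength : ℤ) + t) : x ∈ M.base h.component :=
  ⟨⟨1 + t, h.mem_vertices S.one_mem⟩, (h.mem_supp_iff _).2 ⟨1, S.one_mem, rfl⟩,
    ⟨_, h.mem_vertices S.last_mem⟩, (h.mem_supp_iff _).2 ⟨_, S.last_mem, rfl⟩, h1, h2⟩

/-- The leftmost point of the component is `1 + t`, which recovers the shift. -/
lemma Occurs.eq_of_component_eq {t t' : ℤ} (h : M.Occurs S t) (h' : M.Occurs S t')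
    (e : h.component = h'.component) : t = t' := by
  have key : ∀ {t t' : ℤ} (h : M.Occurs S t) (h' : M.Occurs S t'),
      h.component = h'.component → t ≤ t' := by
    intro t t' h h' e
    have := (h'.mem_supp_iff ⟨1 + t', h'.mem_vertices S.one_mem⟩).2 ⟨1, S.one_mem, rfl⟩
    rw [← e, h.mem_supp_iff] at this
    obtain ⟨s, hs, e'⟩ := this
    have := Finset.mem_Icc.1 (S.support_subset hs)
    dsimp only at e'
    omega
  exact le_antisymm (key h h' e) (key h' h e.symm)

/-- If the shifts were closer, the point `1 + t'` would lie in both bases. This is how strength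
enters the count. -/
lemma Occurs.separated (hS : S.IsStrong) {t t' : ℤ} (h : M.Occurs S t) (h' : M.Occurs S t')
    (hlt : t < t') : t + 2 * (S.halfLength : ℤ) ≤ t' := by
  by_contra hcon
  have hne : h.component ≠ h'.component := fun e => hlt.ne (h.eq_of_component_eq h' e)
  exact Set.disjoint_left.1 (hS n M _ _ h.hasShape h'.hasShape hne)
    (h.mem_base (x := 1 + t') (by omega) (by omega))
    (h'.mem_base le_rfl (by have := S.halfLength_pos; omega))

/-- The possible positions of `S` in a meandric system of size `n`. -/
noncomputable def _root_.Shape.positions (S : Shape) (n : ℕ) : Finset ℤ :=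
  Finset.Icc 0 (2 * (n : ℤ) - 2 * S.halfLength)

open Classical in
lemma shapeCount_eq (S : Shape) (M : MeandricSystem n) :
    shapeCount S M = ((S.positions n).filter (M.Occurs S)).card := by
  rw [shapeCount, ← Nat.card_eq_finsetCard]
  apply Nat.card_congr
  symm
  refine Equiv.ofBijective (fun t => ⟨(Finset.mem_filter.1 t.2).2.component,
    (Finset.mem_filter.1 t.2).2.hasShape⟩) ⟨?_, ?_⟩
  · rintro ⟨t, ht⟩ ⟨t', ht'⟩ e
    exact Subtype.ext (Occurs.eq_of_component_eq (Finset.mem_filter.1 ht).2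
      (Finset.mem_filter.1 ht').2 (congrArg Subtype.val e))
  · rintro ⟨C, hC⟩
    obtain ⟨t, h, rfl⟩ := exists_occurs_of_hasShape hC
    have := h.bounds
    exact ⟨⟨t, Finset.mem_filter.2 ⟨Finset.mem_Icc.2 (by omega), h⟩⟩, rfl⟩

/-- A meandric system is a pair of matchings. -/
def equivProd (n : ℕ) : MeandricSystem n ≃ NCMatching (vertices n) × NCMatching (vertices n) where
  toFun M := (M.up, M.low)
  invFun p := ⟨p.1, p.2⟩
  left_inv _ := rfl
  right_inv _ := rfl

end MeandricSystem

/-! ### Exact counts and binomial moments -/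

namespace Shape

/-- Half the number of upper half-plane arc endpoints that a copy of `S` takes away from the
unbounded face: `ℓ - c₊`. -/
noncomputable def upDrop (S : Shape) : ℕ := S.halfLength - S.cPlus

/-- The analogue of `upDrop` in the lower half-plane: `ℓ - c₋`. -/
noncomputable def lowDrop (S : Shape) : ℕ := S.halfLength - S.cMinus

/-- The number of meandric systems that contain prescribed disjoint translates of `S`. -/
lemma card_occurs_forall (S : Shape) (n : ℕ) (T : Finset ℤ)
    (hT : ∀ t ∈ T, ∀ t' ∈ T, t < t' → t + 2 * (S.halfLength : ℤ) ≤ t')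
    (hT' : T ⊆ S.positions n) :
    Nat.card {M : MeandricSystem n // ∀ t ∈ T, M.Occurs S t} =
      catalan (n - T.card * S.upDrop) * catalan (n - T.card * S.lowDrop) * S.K ^ T.card := by
  have hb : ∀ t ∈ T, 0 ≤ t ∧ t + 2 * (S.halfLength : ℤ) ≤ 2 * n := by
    intro t ht
    have := Finset.mem_Icc.1 (hT' ht)
    omega
  have e : {M : MeandricSystem n // ∀ t ∈ T, M.Occurs S t} ≃
      {f : NCMatching (vertices n) // ∀ t ∈ T, ∀ s ∈ S.support, f.fn (s + t) = S.up.fn s + t} ×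
      {f : NCMatching (vertices n) // ∀ t ∈ T, ∀ s ∈ S.support, f.fn (s + t) = S.low.fn s + t} :=
    ((MeandricSystem.equivProd n).subtypeEquiv fun M =>
      ⟨fun h => ⟨fun t ht s hs => (h t ht s hs).1, fun t ht s hs => (h t ht s hs).2⟩,
        fun h t ht s hs => ⟨h.1 t ht s hs, h.2 t ht s hs⟩⟩).trans
      (Equiv.subtypeProdEquivProd (p := fun f : NCMatching (vertices n) =>
          ∀ t ∈ T, ∀ s ∈ S.support, f.fn (s + t) = S.up.fn s + t)
        (q := fun f : NCMatching (vertices n) =>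
          ∀ t ∈ T, ∀ s ∈ S.support, f.fn (s + t) = S.low.fn s + t))
  rw [Nat.card_congr e, Nat.card_prod, S.card_matching_blocks S.up n T hT hb,
    S.card_matching_blocks S.low n T hT hb, K, mul_pow, upDrop, lowDrop, cPlus, cMinus]
  ring

lemma card_meandricSystem (n : ℕ) : Fintype.card (MeandricSystem n) = catalan n ^ 2 := by
  rw [← Nat.card_eq_fintype_card, Nat.card_congr (MeandricSystem.equivProd n), Nat.card_prod,
    Nat.card_congr (NCMatching.equivIsNC _)]
  have : Nat.card {f : ℤ → ℤ // IsNC (vertices n) f} = catalan n := by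
    have h := ncCount_eq (vertices n)
    rw [show (vertices n).card = 2 * n by simp; omega, ncNumber_two_mul] at h
    exact h
  rw [this, sq]

end Shape

/-- The `k`-subsets of `P` whose elements have mutual distance at least `d`. -/
def separatedSets (d : ℤ) (P : Finset ℤ) (k : ℕ) : Finset (Finset ℤ) :=
  (P.powersetCard k).filter fun T => ∀ t ∈ T, ∀ t' ∈ T, t < t' → t + d ≤ t'

lemma separatedSets_zero (d : ℤ) (P : Finset ℤ) : (separatedSets d P 0).card = 1 := by
  simp [separatedSets, Finset.filter_singleton]

/-- Placements of `k + 1` separated elements either omit the last position or use it. -/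
lemma card_separatedSets_succ (d : ℕ) (hd : 1 ≤ d) (N : ℤ) (hN : 0 ≤ N) (k : ℕ) :
    (separatedSets d (Finset.Icc 0 N) (k + 1)).card =
      (separatedSets d (Finset.Icc 0 (N - 1)) (k + 1)).card +
        (separatedSets d (Finset.Icc 0 (N - d)) k).card := by
  classical
  have split : separatedSets d (Finset.Icc 0 N) (k + 1) =
      separatedSets d (Finset.Icc 0 (N - 1)) (k + 1) ∪
        (separatedSets d (Finset.Icc 0 (N - d)) k).image (insert N) := by
    ext T
    simp only [separatedSets, Finset.mem_filter, Finset.mem_powersetCard, Finset.mem_union,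
      Finset.mem_image]
    constructor
    · rintro ⟨⟨h1, h2⟩, h3⟩
      by_cases hNT : N ∈ T
      · refine Or.inr ⟨T.erase N, ⟨⟨fun x hx => ?_, ?_⟩, fun t ht t' ht' => ?_⟩,
          Finset.insert_erase hNT⟩
        · rw [Finset.mem_erase] at hx
          have h4 := Finset.mem_Icc.1 (h1 hx.2)
          have := h3 x hx.2 N hNT (by omega)
          exact Finset.mem_Icc.2 (by omega)
        · rw [Finset.card_erase_of_mem hNT, h2]
          rfl
        · exact h3 t (Finset.mem_of_mem_erase ht) t' (Finset.mem_of_mem_erase ht')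
      · refine Or.inl ⟨⟨fun x hx => ?_, h2⟩, h3⟩
        have h4 := Finset.mem_Icc.1 (h1 hx)
        have : x ≠ N := fun h => hNT (h ▸ hx)
        exact Finset.mem_Icc.2 (by omega)
    · rintro (⟨⟨h1, h2⟩, h3⟩ | ⟨T', ⟨⟨h1, h2⟩, h3⟩, rfl⟩)
      · exact ⟨⟨h1.trans (Finset.Icc_subset_Icc le_rfl (by omega)), h2⟩, h3⟩
      · have hb : ∀ x ∈ T', 0 ≤ x ∧ x ≤ N - d := fun x hx => Finset.mem_Icc.1 (h1 hx)
        have hNT : N ∉ T' := fun h => by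
          have := hb N h
          omega
        refine ⟨⟨fun x hx => ?_, by rw [Finset.card_insert_of_notMem hNT, h2]⟩,
          fun t ht t' ht' hlt => ?_⟩
        · rw [Finset.mem_Icc]
          rcases Finset.mem_insert.1 hx with rfl | hx
          · omega
          · have := hb x hx
            omega
        · rcases Finset.mem_insert.1 ht with h5 | h5 <;>
            rcases Finset.mem_insert.1 ht' with h6 | h6
          · omega
          · have := hb t' h6
            omega
          · have := hb t h5
            omega
          · exact h3 t h5 t' h6 hlt
  rw [split, Finset.card_union_of_disjoint, Finset.card_image_of_injOn]
  · intro T hT T' hT' e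
    have nm : ∀ T ∈ separatedSets d (Finset.Icc 0 (N - d)) k, N ∉ T := by
      intro T hT h
      have := Finset.mem_Icc.1 ((Finset.mem_powersetCard.1 (Finset.mem_filter.1 hT).1).1 h)
      omega
    rw [← Finset.erase_insert (nm T hT), ← Finset.erase_insert (nm T' hT')]
    exact congrArg (Finset.erase · N) e
  · rw [Finset.disjoint_left]
    intro T hT hT'
    obtain ⟨T', -, rfl⟩ := Finset.mem_image.1 hT'
    have := Finset.mem_Icc.1 ((Finset.mem_powersetCard.1 (Finset.mem_filter.1 hT).1).1
      (Finset.mem_insert_self N T'))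
    omega

/-- These are the placements of `k` disjoint blocks of length `d` on `L` cells; contracting each
block to one cell leaves `L - (d - 1) * k` cells, of which `k` are chosen. The induction matches
`card_separatedSets_succ` with Pascal's rule. -/
theorem card_separatedSets (d : ℕ) (hd : 1 ≤ d) (k L : ℕ) :
    (separatedSets d (Finset.Icc 0 ((L : ℤ) - d)) k).card = (L - (d - 1) * k).choose k := by
  induction k generalizing L with
  | zero => rw [separatedSets_zero]; simp
  | succ k ihk =>
    induction L with
    | zero =>
      have : Finset.Icc (0 : ℤ) ((0 : ℕ) - d) = ∅ := Finset.Icc_eq_empty (by push_cast; omega)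
      rw [this]
      simp [separatedSets]
    | succ L ihL =>
      obtain ⟨e, rfl⟩ : ∃ e, d = e + 1 := ⟨d - 1, by omega⟩
      simp only [Nat.add_sub_cancel] at ihk ihL ⊢
      by_cases hL : e + 1 ≤ L + 1
      · rw [card_separatedSets_succ _ (by omega) _ (by push_cast; omega)]
        have h1 : ((L + 1 : ℕ) : ℤ) - ((e + 1 : ℕ) : ℤ) - 1 = (L : ℤ) - ((e + 1 : ℕ) : ℤ) := by
          push_cast; ring
        have h2 : ((L + 1 : ℕ) : ℤ) - ((e + 1 : ℕ) : ℤ) - ((e + 1 : ℕ) : ℤ) =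
            ((L - e : ℕ) : ℤ) - ((e + 1 : ℕ) : ℤ) := by
          push_cast [show e ≤ L by omega]; ring
        rw [h1, h2, ihL, ihk, Nat.mul_succ, show L - e - e * k = L - (e * k + e) by omega]
        by_cases h3 : e * k + e ≤ L
        · rw [show L + 1 - (e * k + e) = (L - (e * k + e)) + 1 by omega, Nat.choose_succ_succ,
            add_comm]
        -- Here the blocks do not fit and truncated subtraction gives 0 throughout. The remaining
        -- binomial coefficient vanishes because `e ≤ L` excludes `k = 0`.
        · rw [show L + 1 - (e * k + e) = 0 by omega, show L - (e * k + e) = 0 by omega]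
          have : k ≠ 0 := by
            rintro rfl
            omega
          simp [Nat.choose_eq_zero_of_lt (Nat.pos_of_ne_zero this)]
      · have : Finset.Icc (0 : ℤ) ((L + 1 : ℕ) - (e + 1 : ℕ)) = ∅ :=
          Finset.Icc_eq_empty (by push_cast; omega)
        rw [this, Nat.choose_eq_zero_of_lt]
        · simp [separatedSets]
        · rw [Nat.mul_succ]
          omega

/-- The binomial moments of the number of components of a strong shape. -/
theorem Shape.sum_choose_shapeCount (S : Shape) (hS : S.IsStrong) (n k : ℕ) :
    ∑ M : MeandricSystem n, (shapeCount S M).choose k =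
      (2 * n - (2 * S.halfLength - 1) * k).choose k *
        (catalan (n - k * S.upDrop) * catalan (n - k * S.lowDrop) * S.K ^ k) := by
  classical
  have h1 : ∀ M : MeandricSystem n, (shapeCount S M).choose k =
      ∑ T ∈ (S.positions n).powersetCard k, if ∀ t ∈ T, M.Occurs S t then 1 else 0 := by
    intro M
    rw [MeandricSystem.shapeCount_eq, ← Finset.card_powersetCard, ← Finset.card_filter]
    congr 1
    ext T
    simp only [Finset.mem_powersetCard, Finset.mem_filter, Finset.subset_iff]
    constructor
    · rintro ⟨h1, h2⟩
      exact ⟨⟨fun t ht => (h1 ht).1, h2⟩, fun t ht => (h1 ht).2⟩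
    · rintro ⟨⟨h1, h2⟩, h3⟩
      exact ⟨fun t ht => ⟨h1 ht, h3 t ht⟩, h2⟩
  rw [Finset.sum_congr rfl fun M _ => h1 M, Finset.sum_comm]
  have h2 : ∀ T : Finset ℤ, (∑ M : MeandricSystem n, if ∀ t ∈ T, M.Occurs S t then 1 else 0) =
      Nat.card {M : MeandricSystem n // ∀ t ∈ T, M.Occurs S t} := by
    intro T
    rw [← Finset.card_filter, Nat.card_eq_fintype_card, Fintype.card_subtype]
  rw [Finset.sum_congr rfl fun T _ => h2 T,
    ← Finset.sum_filter_add_sum_filter_not _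
      (fun T : Finset ℤ => ∀ t ∈ T, ∀ t' ∈ T, t < t' → t + ((2 * S.halfLength : ℕ) : ℤ) ≤ t')]
  -- Overlapping position sets contribute nothing, by strength; all separated ones contribute the
  -- same number.
  have h3 : ∀ T ∈ ((S.positions n).powersetCard k).filter
      (fun T : Finset ℤ => ¬ ∀ t ∈ T, ∀ t' ∈ T, t < t' → t + ((2 * S.halfLength : ℕ) : ℤ) ≤ t'),
      Nat.card {M : MeandricSystem n // ∀ t ∈ T, M.Occurs S t} = 0 := by
    intro T hT
    have hT := (Finset.mem_filter.1 hT).2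
    rw [Nat.card_eq_zero]
    left
    constructor
    rintro ⟨M, hM⟩
    apply hT
    intro t ht t' ht' hlt
    have := (hM t ht).separated hS (hM t' ht') hlt
    push_cast
    exact this
  rw [Finset.sum_eq_zero h3, add_zero, Finset.sum_congr rfl (g := fun _ =>
    catalan (n - k * S.upDrop) * catalan (n - k * S.lowDrop) * S.K ^ k)]
  · rw [Finset.sum_const, smul_eq_mul]
    congr 1
    have := card_separatedSets (2 * S.halfLength) (by have := S.halfLength_pos; omega) k (2 * n)
    rw [← this, separatedSets]
    push_cast
    rfl
  · intro T hT
    rw [Finset.mem_filter, Finset.mem_powersetCard] at hT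
    rw [S.card_occurs_forall n T (by simpa using hT.2) hT.1.1, hT.1.2]

/-! ### Poisson averages with mean of order √n -/

open scoped Topology Nat

lemma HasSum.of_eq {f g : ℕ → ℝ} {a b : ℝ} (h : HasSum f a) (hfg : ∀ k, g k = f k) (hab : b = a) :
    HasSum g b := by
  rw [hab, funext hfg]
  exact h

lemma hasSum_exp_series (x : ℝ) : HasSum (fun k : ℕ => x ^ k / k !) (Real.exp x) := by
  rw [Real.exp_eq_exp_ℝ]
  exact NormedSpace.expSeries_div_hasSum_exp x

/-- The first moment of the Poisson weights. -/
lemma hasSum_natCast_mul_exp_series (x : ℝ) :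
    HasSum (fun k : ℕ => (k : ℝ) * (x ^ k / k !)) (x * Real.exp x) := by
  rw [← hasSum_nat_add_iff' 1]
  simp only [Finset.range_one, Finset.sum_singleton, Nat.cast_zero, zero_mul, sub_zero]
  refine ((hasSum_exp_series x).mul_left x).of_eq (fun k => ?_) rfl
  rw [Nat.factorial_succ]
  push_cast
  have : ((k : ℝ) + 1) ≠ 0 := by positivity
  field_simp
  ring

/-- The centred second moment of the Poisson weights. -/
lemma hasSum_sq_mul_exp_series (x : ℝ) :
    HasSum (fun k : ℕ => ((k : ℝ) - x) ^ 2 * (x ^ k / k !)) (x * Real.exp x) := by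
  have h2 : HasSum (fun k : ℕ => (k : ℝ) ^ 2 * (x ^ k / k !)) ((x ^ 2 + x) * Real.exp x) := by
    rw [← hasSum_nat_add_iff' 1]
    simp only [Finset.range_one, Finset.sum_singleton, Nat.cast_zero, ne_eq, OfNat.ofNat_ne_zero,
      not_false_eq_true, zero_pow, zero_mul, sub_zero]
    refine (((hasSum_natCast_mul_exp_series x).add (hasSum_exp_series x)).mul_left x).of_eq
      (fun k => ?_) (by ring)
    · rw [Nat.factorial_succ]
      push_cast
      have : ((k : ℝ) + 1) ≠ 0 := by positivity
      field_simp
      ring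
  exact ((h2.sub ((hasSum_natCast_mul_exp_series x).mul_left (2 * x))).add
    ((hasSum_exp_series x).mul_left (x ^ 2))).of_eq (fun k => by ring) (by ring)

/-- The filter of pairs `(n, k)` with `n → ∞` and `k / √n → ξ`. -/
noncomputable def sqrtScaling (ξ : ℝ) : Filter (ℕ × ℕ) :=
  comap (fun z : ℕ × ℕ => ((z.2 : ℝ) / √(z.1 : ℝ), z.1)) (𝓝 ξ ×ˢ atTop)

lemma tendsto_sqrt_natCast : Tendsto (fun n : ℕ => √(n : ℝ)) atTop atTop :=
  Real.tendsto_sqrt_atTop.comp tendsto_natCast_atTop_atTop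

/-- Poisson averages with mean of order `√n` converge to the value at the mean. -/
theorem tendsto_poisson_average {b : ℕ → ℕ → ℝ} {x : ℕ → ℝ} {ξ L C D κ : ℝ}
    (hx0 : ∀ n, 0 ≤ x n) (hx : Tendsto (fun n : ℕ => x n / √(n : ℝ)) atTop (𝓝 ξ))
    (hb0 : ∀ n k, 0 ≤ b n k) (hb : Tendsto (fun z : ℕ × ℕ => b z.1 z.2) (sqrtScaling ξ) (𝓝 L))
    (hC : ∀ᶠ n : ℕ in atTop, ∀ k : ℕ, (k : ℝ) ≤ κ * n → b n k ≤ C) (hD : ∀ n k, b n k ≤ D ^ k)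
    (hκ : 0 < κ) (hL : 0 ≤ L) (hC0 : 0 ≤ C) (hD0 : 1 ≤ D) :
    Tendsto (fun n => Real.exp (-x n) * ∑' k, x n ^ k / k ! * b n k) atTop (𝓝 L) := by
  -- The extra factor e yields `D ^ k ≤ exp (-κn) * E ^ k` as soon as `k > κn`, which trades the
  -- crude bound for an exponentially small weight.
  set E := D * Real.exp 1 with hE
  have hE0 : 0 < E := by positivity
  have hsum : ∀ n, Summable fun k => x n ^ k / k ! * b n k := by
    intro n
    refine Summable.of_nonneg_of_le (fun k => mul_nonneg (by have := hx0 n; positivity) (hb0 n k))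
      (fun k => ?_) (hasSum_exp_series (x n * D)).summable
    rw [mul_pow, mul_div_right_comm]
    exact mul_le_mul_of_nonneg_left (hD n k) (by have := hx0 n; positivity)
  rw [Metric.tendsto_nhds]
  intro ε hε
  have h1 := hb.eventually (Metric.ball_mem_nhds L (half_pos hε))
  rw [sqrtScaling, eventually_comap, eventually_prod_iff] at h1
  obtain ⟨pa, hpa, pb, hpb, hp⟩ := h1
  obtain ⟨δ, hδ, hball⟩ := Metric.eventually_nhds_iff.1 hpa
  have hsq := tendsto_sqrt_natCast
  have hx1 : Tendsto (fun n : ℕ => x n / n) atTop (𝓝 0) := by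
    have := hx.mul hsq.inv_tendsto_atTop
    rw [mul_zero] at this
    refine this.congr fun n => ?_
    simp only [Pi.inv_apply]
    rw [← div_eq_mul_inv, div_div, Real.mul_self_sqrt (Nat.cast_nonneg n)]
  -- This is the Poisson mean of the pointwise bound `point`: the variance equals `x n`, and the
  -- mean of `E ^ k` is `exp ((E - 1) * x n)`. Both error terms vanish because `x n / n` tends to 0.
  have t1 : Tendsto (fun n : ℕ => ε / 2 + ((C + L) * (4 / δ ^ 2) * (x n / n) +
      Real.exp (n * ((E - 1) * (x n / n) - κ)))) atTop (𝓝 (ε / 2 + ((C + L) * (4 / δ ^ 2) * 0 + 0))) := by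
    refine tendsto_const_nhds.add ((hx1.const_mul _).add (Real.tendsto_exp_atBot.comp ?_))
    apply Tendsto.atTop_mul_neg (C := (E - 1) * 0 - κ) (by linarith) tendsto_natCast_atTop_atTop
    exact (hx1.const_mul _).sub_const κ
  have hlt : ε / 2 + ((C + L) * (4 / δ ^ 2) * 0 + 0) < ε := by linarith
  have hclose := Metric.tendsto_nhds.1 hx (δ / 2) (half_pos hδ)
  filter_upwards [t1.eventually_lt_const hlt, hclose, hC, hpb, eventually_gt_atTop 0]
    with n hn hxn hCn hpbn hn0
  have hn0' : (0 : ℝ) < n := Nat.cast_pos.2 hn0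
  have hs0 : 0 < √(n : ℝ) := Real.sqrt_pos.2 hn0'
  have hss : √(n : ℝ) ^ 2 = n := Real.sq_sqrt hn0'.le
  have hxn0 := hx0 n
  -- Three regimes: near `ξ√n` the limit of `b` gives `ε / 2`; away from it the quadratic term is at
  -- least `C + L`, as in Chebyshev's inequality; beyond `κn` the last term absorbs `D ^ k`.
  have point : ∀ k : ℕ, |b n k - L| ≤ ε / 2 + ((C + L) * (4 / (δ ^ 2 * n)) * ((k : ℝ) - x n) ^ 2 +
      Real.exp (-(κ * n)) * E ^ k) := by
    intro k
    have hexp0 : 0 ≤ Real.exp (-(κ * n)) * E ^ k := by positivity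
    have hq0 : 0 ≤ (C + L) * (4 / (δ ^ 2 * n)) * ((k : ℝ) - x n) ^ 2 := by positivity
    by_cases hk : dist ((k : ℝ) / √(n : ℝ)) ξ < δ
    · have := hp (hball hk) hpbn (n, k) rfl
      rw [Real.dist_eq] at this
      dsimp only at this
      linarith
    · have hfar : δ / 2 * √(n : ℝ) ≤ |(k : ℝ) - x n| := by
        have h3 : δ / 2 ≤ |((k : ℝ) - x n) / √(n : ℝ)| := by
          have := dist_triangle ((k : ℝ) / √(n : ℝ)) (x n / √(n : ℝ)) ξ
          rw [Real.dist_eq (_ / _) (_ / _), ← sub_div] at this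
          linarith [not_lt.1 hk]
        rwa [abs_div, abs_of_pos hs0, le_div_iff₀ hs0] at h3
      have hone : 1 ≤ 4 / (δ ^ 2 * n) * ((k : ℝ) - x n) ^ 2 := by
        rw [← sq_abs ((k : ℝ) - x n), div_mul_eq_mul_div, one_le_div (by positivity)]
        have := pow_le_pow_left₀ (by positivity) hfar 2
        rw [mul_pow, hss] at this
        linarith
      have hq1 : C + L ≤ (C + L) * (4 / (δ ^ 2 * n)) * ((k : ℝ) - x n) ^ 2 := by
        rw [mul_assoc]
        exact le_mul_of_one_le_right (by positivity) hone
      have hbk : b n k ≤ C + Real.exp (-(κ * n)) * E ^ k := by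
        by_cases hk' : (k : ℝ) ≤ κ * n
        · linarith [hCn k hk']
        · have : D ^ k ≤ Real.exp (-(κ * n)) * E ^ k := by
            rw [hE, mul_pow, ← Real.exp_nat_mul, mul_one, mul_left_comm, ← Real.exp_add]
            refine le_mul_of_one_le_right (by positivity) (Real.one_le_exp ?_)
            linarith [not_le.1 hk']
          linarith [hD n k]
      rw [abs_le]
      constructor
      · linarith [hb0 n k]
      · linarith
  have hsum2 : HasSum (fun k : ℕ => x n ^ k / k ! * (ε / 2 +
      ((C + L) * (4 / (δ ^ 2 * n)) * ((k : ℝ) - x n) ^ 2 + Real.exp (-(κ * n)) * E ^ k)))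
      (Real.exp (x n) * (ε / 2 + ((C + L) * (4 / δ ^ 2) * (x n / n) +
        Real.exp (n * ((E - 1) * (x n / n) - κ))))) := by
    refine (((hasSum_exp_series (x n)).mul_left (ε / 2)).add
      (((hasSum_sq_mul_exp_series (x n)).mul_left ((C + L) * (4 / (δ ^ 2 * n)))).add
        ((hasSum_exp_series (x n * E)).mul_left (Real.exp (-(κ * n)))))).of_eq (fun k => ?_) ?_
    · rw [mul_pow]
      ring
    · have : Real.exp (n * ((E - 1) * (x n / n) - κ)) =
          Real.exp (-(κ * n)) * Real.exp (x n * E) * (Real.exp (x n))⁻¹ := by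
        rw [← Real.exp_neg, ← Real.exp_add, ← Real.exp_add]
        congr 1
        field_simp
        ring
      rw [this]
      field_simp
  have hdiff : (∑' k, x n ^ k / k ! * b n k) - Real.exp (x n) * L =
      ∑' k, x n ^ k / k ! * (b n k - L) := by
    have h5 := (hsum n).hasSum.sub ((hasSum_exp_series (x n)).mul_right L)
    rw [← h5.tsum_eq]
    exact tsum_congr fun k => by ring
  rw [Real.dist_eq]
  have hfin : |(∑' k, x n ^ k / k ! * b n k) - Real.exp (x n) * L| ≤ Real.exp (x n) *
      (ε / 2 + ((C + L) * (4 / δ ^ 2) * (x n / n) +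
        Real.exp (n * ((E - 1) * (x n / n) - κ)))) := by
    rw [hdiff, ← hsum2.tsum_eq, ← Real.norm_eq_abs]
    refine tsum_of_norm_bounded hsum2.summable.hasSum fun k => ?_
    rw [norm_mul, Real.norm_eq_abs, Real.norm_eq_abs, abs_of_nonneg (by positivity)]
    exact mul_le_mul_of_nonneg_left (point k) (by positivity)
  have hre : Real.exp (-x n) * (∑' k, x n ^ k / k ! * b n k) - L =
      Real.exp (-x n) * ((∑' k, x n ^ k / k ! * b n k) - Real.exp (x n) * L) := by
    rw [mul_sub, ← mul_assoc, ← Real.exp_add, neg_add_cancel, Real.exp_zero, one_mul]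
  rw [hre, abs_mul, abs_of_pos (Real.exp_pos _)]
  refine lt_of_le_of_lt (mul_le_mul_of_nonneg_left hfin (Real.exp_pos _).le) ?_
  rw [← mul_assoc, ← Real.exp_add, neg_add_cancel, Real.exp_zero, one_mul]
  exact hn

section SqrtScaling

variable {ξ : ℝ}

lemma tendsto_div_sqrt_sqrtScaling :
    Tendsto (fun z : ℕ × ℕ => (z.2 : ℝ) / √(z.1 : ℝ)) (sqrtScaling ξ) (𝓝 ξ) :=
  tendsto_fst.comp tendsto_comap

lemma tendsto_fst_sqrtScaling : Tendsto (fun z : ℕ × ℕ => z.1) (sqrtScaling ξ) atTop :=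
  tendsto_snd.comp tendsto_comap

lemma tendsto_sq_div_sqrtScaling :
    Tendsto (fun z : ℕ × ℕ => (z.2 : ℝ) ^ 2 / z.1) (sqrtScaling ξ) (𝓝 (ξ ^ 2)) := by
  refine (tendsto_div_sqrt_sqrtScaling.pow 2).congr fun z => ?_
  rw [div_pow, Real.sq_sqrt (Nat.cast_nonneg _)]

lemma tendsto_div_sqrtScaling :
    Tendsto (fun z : ℕ × ℕ => (z.2 : ℝ) / z.1) (sqrtScaling ξ) (𝓝 0) := by
  have := tendsto_div_sqrt_sqrtScaling (ξ := ξ) |>.mul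
    (tendsto_sqrt_natCast.comp tendsto_fst_sqrtScaling).inv_tendsto_atTop
  rw [mul_zero] at this
  refine this.congr fun z => ?_
  simp only [Pi.inv_apply, Function.comp]
  rw [← div_eq_mul_inv, div_div, Real.mul_self_sqrt (Nat.cast_nonneg _)]

lemma tendsto_cube_div_sq_sqrtScaling :
    Tendsto (fun z : ℕ × ℕ => (z.2 : ℝ) ^ 3 / (z.1 : ℝ) ^ 2) (sqrtScaling ξ) (𝓝 0) := by
  have := (tendsto_sq_div_sqrtScaling (ξ := ξ)).mul tendsto_div_sqrtScaling
  rw [mul_zero] at this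
  refine this.congr fun z => ?_
  rw [div_mul_div_comm]
  ring

lemma eventually_mul_le_sqrtScaling (c : ℕ) : ∀ᶠ z in sqrtScaling ξ, 0 < z.1 ∧ z.2 * c ≤ z.1 := by
  have h := (tendsto_div_sqrtScaling (ξ := ξ)).eventually_lt_const
    (show (0 : ℝ) < 1 / (c + 1) by positivity)
  filter_upwards [h, tendsto_fst_sqrtScaling.eventually_gt_atTop 0] with z hz hz0
  refine ⟨hz0, ?_⟩
  rw [div_lt_div_iff₀ (Nat.cast_pos.2 hz0) (by positivity), one_mul] at hz
  have : z.2 * (c + 1) < z.1 := by exact_mod_cast hz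
  nlinarith

end SqrtScaling

/-! ### Asymptotics of the Catalan and placement ratios -/

lemma succ_mul_catalan_succ (m : ℕ) : (m + 2) * catalan (m + 1) = 2 * (2 * m + 1) * catalan m := by
  have h1 := succ_mul_catalan_eq_centralBinom m
  have h2 := succ_mul_catalan_eq_centralBinom (m + 1)
  have h3 := Nat.succ_mul_centralBinom_succ m
  rw [← h1, ← h2] at h3
  have : (m + 1) * ((m + 2) * catalan (m + 1)) = (m + 1) * (2 * (2 * m + 1) * catalan m) := by
    rw [show m + 2 = m + 1 + 1 by ring, h3]
    ring
  exact Nat.eq_of_mul_eq_mul_left (Nat.succ_pos m) this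

lemma catalan_pos (m : ℕ) : 0 < catalan m := by
  have h := succ_mul_catalan_eq_centralBinom m
  have := Nat.centralBinom_pos m
  rw [← h] at this
  exact Nat.pos_of_mul_pos_left this

lemma four_mul_catalan (m : ℕ) :
    4 * (catalan m : ℝ) = catalan (m + 1) * (1 + 3 / (2 * m + 1)) := by
  have h : ((m : ℝ) + 2) * catalan (m + 1) = 2 * (2 * m + 1) * catalan m := by
    exact_mod_cast succ_mul_catalan_succ m
  have : (2 * (m : ℝ) + 1) ≠ 0 := by positivity
  field_simp
  linarith

lemma catalan_mono : Monotone catalan := by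
  refine monotone_nat_of_le_succ fun m => ?_
  have h := succ_mul_catalan_succ m
  have := catalan_pos m
  rcases m with _ | m
  · simp
  · have h1 : m + 1 + 2 ≤ 2 * (2 * (m + 1) + 1) := by omega
    have h2 := Nat.mul_le_mul_right (catalan (m + 1)) h1
    rw [← h] at h2
    exact Nat.le_of_mul_le_mul_left h2 (by omega)

/-- `4 ^ j Cat (n - j) / Cat n`. -/
noncomputable def catRatio (n j : ℕ) : ℝ := 4 ^ j * catalan (n - j) / catalan n

lemma catRatio_nonneg (n j : ℕ) : 0 ≤ catRatio n j := by unfold catRatio; positivity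

lemma catRatio_le_pow (n j : ℕ) : catRatio n j ≤ 4 ^ j := by
  have := catalan_pos n
  rw [catRatio, div_le_iff₀ (by exact_mod_cast this)]
  have h : (catalan (n - j) : ℝ) ≤ catalan n := by exact_mod_cast catalan_mono (Nat.sub_le n j)
  gcongr

lemma catRatio_zero (n : ℕ) : catRatio n 0 = 1 := by
  have : (catalan n : ℝ) ≠ 0 := by exact_mod_cast (catalan_pos n).ne'
  simp [catRatio, this]

lemma catRatio_succ {n j : ℕ} (h : j + 1 ≤ n) :
    catRatio n (j + 1) = catRatio n j * (1 + 3 / (2 * ((n - (j + 1) : ℕ) : ℝ) + 1)) := by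
  have h1 := four_mul_catalan (n - (j + 1))
  rw [show n - (j + 1) + 1 = n - j by omega] at h1
  rw [catRatio, catRatio, pow_succ, mul_assoc, h1]
  ring

lemma one_le_catRatio {n j : ℕ} (h : j ≤ n) : 1 ≤ catRatio n j := by
  induction j with
  | zero => rw [catRatio_zero]
  | succ j ih =>
    rw [catRatio_succ h]
    refine one_le_mul_of_one_le_of_one_le (ih (by omega)) ?_
    have : (0 : ℝ) ≤ 3 / (2 * ((n - (j + 1) : ℕ) : ℝ) + 1) := by positivity
    linarith

/-- The ratio telescopes into `j` factors, each at most `1 + 3 / n` as long as at least half of the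
index `n` remains. -/
lemma catRatio_le_exp {n j : ℕ} (h : 2 * j ≤ n) (hn : 0 < n) :
    catRatio n j ≤ Real.exp (3 * j / n) := by
  have hn' : (0 : ℝ) < n := Nat.cast_pos.2 hn
  induction j with
  | zero => rw [catRatio_zero]; simp
  | succ j ih =>
    rw [catRatio_succ (by omega),
      show (3 * ((j + 1 : ℕ) : ℝ) / n) = 3 * j / n + 3 / n by push_cast; ring, Real.exp_add]
    refine mul_le_mul (ih (by omega)) ?_ (by positivity) (Real.exp_pos _).le
    have h1 : (3 : ℝ) / (2 * ((n - (j + 1) : ℕ) : ℝ) + 1) ≤ 3 / n := by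
      refine div_le_div_of_nonneg_left (by norm_num) hn' ?_
      have : n ≤ 2 * (n - (j + 1)) + 1 := by omega
      exact_mod_cast this
    linarith [Real.add_one_le_exp (3 / (n : ℝ))]

lemma tendsto_catRatio (p : ℕ) (ξ : ℝ) :
    Tendsto (fun z : ℕ × ℕ => catRatio z.1 (z.2 * p)) (sqrtScaling ξ) (𝓝 1) := by
  have hup : Tendsto (fun z : ℕ × ℕ => Real.exp (3 * p * ((z.2 : ℝ) / z.1))) (sqrtScaling ξ)
      (𝓝 1) := by
    have := (tendsto_div_sqrtScaling (ξ := ξ)).const_mul (3 * (p : ℝ))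
    rw [mul_zero] at this
    rw [← Real.exp_zero]
    exact (Real.continuous_exp.tendsto _).comp this
  refine tendsto_of_tendsto_of_tendsto_of_le_of_le' tendsto_const_nhds hup ?_ ?_
  · filter_upwards [eventually_mul_le_sqrtScaling p] with z hz
    exact one_le_catRatio hz.2
  · filter_upwards [eventually_mul_le_sqrtScaling (2 * p)] with z hz
    refine (catRatio_le_exp (by rw [mul_left_comm]; exact hz.2) hz.1).trans (le_of_eq ?_)
    push_cast
    ring_nf

/-- The proportion of the `k`-tuples of positions, out of `2n`, at which blocks of length `d` can be
placed. -/
noncomputable def placeRatio (d n k : ℕ) : ℝ :=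
  k ! * ((2 * n - (d - 1) * k).choose k : ℝ) / (2 * n) ^ k

lemma placeRatio_nonneg (d n k : ℕ) : 0 ≤ placeRatio d n k := by unfold placeRatio; positivity

lemma placeRatio_eq_descFactorial (d n k : ℕ) :
    placeRatio d n k = ((2 * n - (d - 1) * k).descFactorial k : ℝ) / (2 * n) ^ k := by
  rw [placeRatio, Nat.descFactorial_eq_factorial_mul_choose, Nat.cast_mul]

lemma placeRatio_le_one (d n k : ℕ) : placeRatio d n k ≤ 1 := by
  rw [placeRatio_eq_descFactorial]
  refine div_le_one_of_le₀ ?_ (by positivity)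
  have h1 := Nat.descFactorial_le_pow (2 * n - (d - 1) * k) k
  have h2 : (2 * n - (d - 1) * k) ^ k ≤ (2 * n) ^ k := Nat.pow_le_pow_left (Nat.sub_le _ _) k
  exact_mod_cast h1.trans h2

lemma placeRatio_eq_prod {d n k : ℕ} (hd : 1 ≤ d) (h : d * k ≤ 2 * n) (hn : 0 < n) :
    placeRatio d n k =
      ∏ i ∈ Finset.range k, (1 - (((d : ℝ) - 1) * k + i) / (2 * n)) := by
  have hn' : (0 : ℝ) < n := Nat.cast_pos.2 hn
  obtain ⟨e, rfl⟩ : ∃ e, d = e + 1 := ⟨d - 1, by omega⟩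
  rw [placeRatio_eq_descFactorial, Nat.descFactorial_eq_prod_range, Nat.cast_prod,
    Nat.add_sub_cancel]
  have : ((2 * (n : ℝ)) ^ k) = ∏ i ∈ Finset.range k, (2 * (n : ℝ)) := by simp
  rw [this, ← Finset.prod_div_distrib]
  refine Finset.prod_congr rfl fun i hi => ?_
  have hi := Finset.mem_range.1 hi
  have h' : e * k + k ≤ 2 * n := by linarith
  rw [Nat.cast_sub (by omega), Nat.cast_sub (by omega)]
  push_cast
  field_simp
  ring

/-- Follows from 1/(1 - y) ≤ 1 + y + 2y². The quadratic loss, summed over the factors of the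
placement ratio, is of order k³/n², which is negligible for k of order √n. -/
lemma exp_neg_le_one_sub {y : ℝ} (h1 : y ≤ 1 / 2) :
    Real.exp (-(y + 2 * y ^ 2)) ≤ 1 - y := by
  have h2 : 0 < 1 - y := by linarith
  have h3 : (1 - y)⁻¹ ≤ Real.exp (y + 2 * y ^ 2) := by
    have e : (1 - y)⁻¹ = 1 + y / (1 - y) := by field_simp; ring
    have h4 : y / (1 - y) ≤ y + 2 * y ^ 2 := by
      rw [div_le_iff₀ h2]
      nlinarith [mul_nonneg (sq_nonneg y) (by linarith : 0 ≤ 1 - 2 * y)]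
    rw [e]
    linarith [Real.add_one_le_exp (y + 2 * y ^ 2)]
  rw [Real.exp_neg]
  exact inv_le_of_inv_le₀ h2 h3

/-- The linear term of the logarithm of the placement ratio. The constant (2d - 1)/4 is half of (d -
1) + 1/2, the 1/2 coming from the sum of the indices `i`. -/
lemma sum_place_shift (d : ℝ) (n k : ℕ) :
    ∑ i ∈ Finset.range k, ((d - 1) * k + i) / (2 * n) =
      (2 * d - 1) / 4 * ((k : ℝ) ^ 2 / n) - 1 / 4 * (k / n) := by
  have h : ∀ m : ℕ, ∑ i ∈ Finset.range m, ((d - 1) * k + i) / (2 * (n : ℝ)) =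
      ((d - 1) * k * m + m * (m - 1) / 2) / (2 * n) := by
    intro m
    induction m with
    | zero => simp
    | succ m ih =>
      rw [Finset.sum_range_succ, ih, ← add_div]
      push_cast
      ring
  rw [h]
  ring

lemma placeRatio_le_exp {d n k : ℕ} (hd : 1 ≤ d) (h : d * k ≤ 2 * n) (hn : 0 < n) :
    placeRatio d n k ≤ Real.exp (-((2 * d - 1) / 4 * ((k : ℝ) ^ 2 / n) - 1 / 4 * (k / n))) := by
  have hn' : (0 : ℝ) < n := Nat.cast_pos.2 hn
  rw [placeRatio_eq_prod hd h hn, ← sum_place_shift, ← Finset.sum_neg_distrib, Real.exp_sum]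
  refine Finset.prod_le_prod (fun i hi => ?_) fun i _ => ?_
  · have hi : (i : ℝ) + 1 ≤ k := by exact_mod_cast Finset.mem_range.1 hi
    have h' : (d : ℝ) * k ≤ 2 * n := by exact_mod_cast h
    rw [sub_nonneg, div_le_one (by positivity)]
    linarith
  · have := Real.add_one_le_exp (-(((d : ℝ) - 1) * k + i) / (2 * n))
    rw [neg_div] at this
    linarith

/-- Every shift y in the product is at most dk/(2n) ≤ 1/2, so the `k` corrections 2y² add up to at
most d²k³/(2n²). -/
lemma exp_le_placeRatio {d n k : ℕ} (hd : 1 ≤ d) (h : d * k ≤ n) (hn : 0 < n) :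
    Real.exp (-((2 * d - 1) / 4 * ((k : ℝ) ^ 2 / n) - 1 / 4 * (k / n)) -
      (d : ℝ) ^ 2 / 2 * ((k : ℝ) ^ 3 / (n : ℝ) ^ 2)) ≤ placeRatio d n k := by
  have hn' : (0 : ℝ) < n := Nat.cast_pos.2 hn
  have h' : (d : ℝ) * k ≤ n := by exact_mod_cast h
  have hd' : (1 : ℝ) ≤ d := by exact_mod_cast hd
  have e : (d : ℝ) ^ 2 / 2 * ((k : ℝ) ^ 3 / (n : ℝ) ^ 2) =
      ∑ i ∈ Finset.range k, 2 * ((d * k) / (2 * (n : ℝ))) ^ 2 := by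
    rw [Finset.sum_const, Finset.card_range, nsmul_eq_mul]
    field_simp
  rw [placeRatio_eq_prod hd (by omega) hn, ← sum_place_shift, e, ← Finset.sum_neg_distrib,
    ← Finset.sum_sub_distrib, Real.exp_sum]
  refine Finset.prod_le_prod (fun i _ => (Real.exp_pos _).le) fun i hi => ?_
  have hi : (i : ℝ) + 1 ≤ k := by exact_mod_cast Finset.mem_range.1 hi
  have y0 : 0 ≤ (((d : ℝ) - 1) * k + i) / (2 * n) := by
    have : 0 ≤ ((d : ℝ) - 1) * k := mul_nonneg (by linarith) (by positivity)
    positivity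
  have y1 : (((d : ℝ) - 1) * k + i) / (2 * n) ≤ (d * k) / (2 * (n : ℝ)) := by
    gcongr
    linarith
  have y2 : (d * k) / (2 * (n : ℝ)) ≤ 1 / 2 := by
    rw [div_le_div_iff₀ (by positivity) (by norm_num)]
    linarith
  refine le_trans (Real.exp_le_exp.2 ?_) (exp_neg_le_one_sub (y1.trans y2))
  have := pow_le_pow_left₀ y0 y1 2
  linarith

lemma tendsto_placeRatio {d : ℕ} (hd : 1 ≤ d) (ξ : ℝ) :
    Tendsto (fun z : ℕ × ℕ => placeRatio d z.1 z.2) (sqrtScaling ξ)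
      (𝓝 (Real.exp (-((2 * d - 1) / 4 * ξ ^ 2)))) := by
  have t1 : Tendsto (fun z : ℕ × ℕ => -((2 * (d : ℝ) - 1) / 4 * ((z.2 : ℝ) ^ 2 / z.1) -
      1 / 4 * (z.2 / z.1))) (sqrtScaling ξ) (𝓝 (-((2 * d - 1) / 4 * ξ ^ 2 - 1 / 4 * 0))) :=
    ((tendsto_sq_div_sqrtScaling.const_mul _).sub (tendsto_div_sqrtScaling.const_mul _)).neg
  have t2 := t1.sub ((tendsto_cube_div_sq_sqrtScaling (ξ := ξ)).const_mul ((d : ℝ) ^ 2 / 2))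
  rw [mul_zero, sub_zero] at t1 t2
  rw [mul_zero, sub_zero] at t2
  refine tendsto_of_tendsto_of_tendsto_of_le_of_le' ((Real.continuous_exp.tendsto _).comp t2)
    ((Real.continuous_exp.tendsto _).comp t1) ?_ ?_
  · filter_upwards [eventually_mul_le_sqrtScaling d] with z hz
    exact exp_le_placeRatio hd (by rw [mul_comm]; exact hz.2) hz.1
  · filter_upwards [eventually_mul_le_sqrtScaling d] with z hz
    exact placeRatio_le_exp hd (by have := hz.2; rw [mul_comm] at this; omega) hz.1

/-- Asymptotics of the generating function of the binomial moments. -/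
theorem tendsto_binomialMoment_series {d p q : ℕ} (hd : 1 ≤ d) {x : ℕ → ℝ} {ξ : ℝ}
    (hx0 : ∀ n, 0 ≤ x n) (hx : Tendsto (fun n : ℕ => x n / √(n : ℝ)) atTop (𝓝 ξ)) :
    Tendsto (fun n => Real.exp (-x n) * ∑' k, x n ^ k / k ! *
      (placeRatio d n k * catRatio n (k * p) * catRatio n (k * q))) atTop
      (𝓝 (Real.exp (-((2 * d - 1) / 4 * ξ ^ 2)))) := by
  -- The choice of `κ` gives `2 * k * r ≤ n` for `r ≤ p + q`, so each Catalan ratio is at most e³ in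
  -- that range. `D` comes from the bound `catRatio_le_pow`, valid for all `k`.
  refine tendsto_poisson_average (b := fun n k => placeRatio d n k * catRatio n (k * p) *
    catRatio n (k * q)) (C := Real.exp 3 * Real.exp 3) (D := 4 ^ (p + q))
    (κ := 1 / (2 * (p + q + 1))) hx0 hx (fun n k => ?_) ?_ ?_ (fun n k => ?_) (by positivity)
    (Real.exp_pos _).le (by positivity) (one_le_pow₀ (by norm_num))
  · exact mul_nonneg (mul_nonneg (placeRatio_nonneg _ _ _) (catRatio_nonneg _ _))
      (catRatio_nonneg _ _)
  · have := ((tendsto_placeRatio hd ξ).mul (tendsto_catRatio p ξ)).mul (tendsto_catRatio q ξ)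
    simpa only [mul_one] using this
  · filter_upwards [eventually_gt_atTop 0] with n hn k hk
    have hn' : (0 : ℝ) < n := Nat.cast_pos.2 hn
    have key : ∀ r : ℕ, r ≤ p + q → catRatio n (k * r) ≤ Real.exp 3 := by
      intro r hr
      have h1 : (k : ℝ) * (2 * (p + q + 1)) ≤ n := by
        rw [div_mul_eq_mul_div, one_mul, le_div_iff₀ (by positivity)] at hk
        exact hk
      have h2 : k * (2 * (p + q + 1)) ≤ n := by exact_mod_cast h1
      have h3 : 2 * (k * r) ≤ n := by nlinarith
      refine (catRatio_le_exp h3 hn).trans (Real.exp_le_exp.2 ?_)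
      have h4 : (2 : ℝ) * ((k * r : ℕ) : ℝ) ≤ n := by exact_mod_cast h3
      rw [div_le_iff₀ hn']
      have : (0 : ℝ) ≤ ((k * r : ℕ) : ℝ) := Nat.cast_nonneg _
      linarith
    have h5 := mul_le_mul (placeRatio_le_one d n k) (key p (by omega)) (catRatio_nonneg _ _)
      zero_le_one
    rw [one_mul] at h5
    exact mul_le_mul h5 (key q (by omega)) (catRatio_nonneg _ _) (Real.exp_pos _).le
  · have h5 := mul_le_mul (placeRatio_le_one d n k) (catRatio_le_pow n (k * p))
      (catRatio_nonneg _ _) zero_le_one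
    rw [one_mul] at h5
    refine (mul_le_mul h5 (catRatio_le_pow n (k * q)) (catRatio_nonneg _ _) (by positivity)).trans
      (le_of_eq ?_)
    rw [← pow_add, ← pow_mul]
    congr 1
    ring

/-! ### Convergence of the moment generating functions and positivity of the variance -/

namespace Shape

variable (S : Shape)

lemma K_pos : 0 < S.K :=
  Nat.mul_pos (Finset.prod_pos fun _ _ => catalan_pos _) (Finset.prod_pos fun _ _ => catalan_pos _)

lemma fourPow_eq : S.fourPow = 4 ^ (S.upDrop + S.lowDrop) := by
  have h1 := S.card_unboundedFace_lt S.up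
  have h2 := S.card_unboundedFace_lt S.low
  rw [fourPow, ← zpow_natCast]
  congr 1
  rw [upDrop, lowDrop, cPlus, cMinus]
  omega

lemma fourPow_pos : 0 < S.fourPow := by
  rw [fourPow_eq]
  positivity

lemma mean_pos : 0 < S.mean := by
  have := S.K_pos
  have := S.fourPow_pos
  unfold mean
  positivity

/-- The limiting variance. -/
noncomputable def var : ℝ := S.mean * (1 - S.mean * (4 * (S.halfLength : ℝ) - 1) / 2)

lemma stdDev_eq_sqrt_var : S.stdDev = √S.var := by
  rw [stdDev, var, mean]
  congr 1
  ring

/-- Vanishing would force K(4ℓ - 1) to be a power of 2, whereas 4ℓ - 1 is odd and at least 3. -/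
lemma var_ne_zero : S.var ≠ 0 := by
  intro h
  rcases mul_eq_zero.1 h with h | h
  · exact S.mean_pos.ne' h
  · rw [mean, fourPow_eq] at h
    have hl := S.halfLength_pos
    have h1 : (S.K : ℝ) * (4 * (S.halfLength : ℝ) - 1) = 4 ^ (S.upDrop + S.lowDrop) := by
      field_simp at h
      linarith
    have h2 : S.K * (4 * S.halfLength - 1) = 2 ^ (2 * (S.upDrop + S.lowDrop)) := by
      rw [pow_mul]
      have : ((S.K * (4 * S.halfLength - 1) : ℕ) : ℝ) = ((4 ^ (S.upDrop + S.lowDrop) : ℕ) : ℝ) := by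
        rw [Nat.cast_mul, Nat.cast_sub (by omega)]
        push_cast
        exact h1
      exact_mod_cast this
    obtain ⟨j, -, hj⟩ := (Nat.dvd_prime_pow Nat.prime_two).1 (Dvd.intro_left _ h2)
    rcases j with _ | j
    · rw [pow_zero] at hj
      omega
    · rw [pow_succ] at hj
      omega

/-- The generating function of the binomial moments, in terms of Poisson weights. -/
lemma sum_pow_shapeCount (hS : S.IsStrong) (n : ℕ) (u : ℝ) :
    (∑ M : MeandricSystem n, (1 + u) ^ shapeCount S M) / (catalan n : ℝ) ^ 2 =
      ∑' k, (u * (S.mean * n)) ^ k / k ! *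
        (placeRatio (2 * S.halfLength) n k * catRatio n (k * S.upDrop) *
          catRatio n (k * S.lowDrop)) := by
  have h1 : ∀ M : MeandricSystem n, HasSum
      (fun k => u ^ k * ((shapeCount S M).choose k : ℝ)) ((1 + u) ^ shapeCount S M) := by
    intro M
    have := hasSum_sum_of_ne_finset_zero (L := SummationFilter.unconditional ℕ) (f := fun k => u ^ k * ((shapeCount S M).choose k : ℝ))
      (s := Finset.range (shapeCount S M + 1)) (fun k hk => by
        rw [Finset.mem_range, not_lt] at hk
        rw [Nat.choose_eq_zero_of_lt (by omega)]
        simp)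
    convert! this using 1
    rw [add_comm, add_pow]
    simp
  have h2 := (hasSum_sum (s := Finset.univ) fun M (_ : M ∈ Finset.univ) => h1 M).div_const
    ((catalan n : ℝ) ^ 2)
  rw [← h2.tsum_eq]
  refine tsum_congr fun k => ?_
  have h3 := S.sum_choose_shapeCount hS n k
  have h4 : (∑ M : MeandricSystem n, ((shapeCount S M).choose k : ℝ)) =
      ((2 * n - (2 * S.halfLength - 1) * k).choose k : ℝ) *
        (catalan (n - k * S.upDrop) * catalan (n - k * S.lowDrop) * (S.K : ℝ) ^ k) := by
    exact_mod_cast h3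
  rw [← Finset.mul_sum, h4, placeRatio, catRatio, catRatio, mean, fourPow_eq]
  -- Size 0 is separate because the normalization divides by `n`; there the binomial coefficient
  -- kills every `k ≥ 1`.
  rcases Nat.eq_zero_or_pos n with rfl | hn
  · rcases k with _ | k
    · simp
    · have : 2 * 0 - (2 * S.halfLength - 1) * (k + 1) < k + 1 := by omega
      rw [Nat.choose_eq_zero_of_lt this]
      simp
  have hn' : (n : ℝ) ≠ 0 := by exact_mod_cast hn.ne'
  have hc : (catalan n : ℝ) ≠ 0 := by exact_mod_cast (catalan_pos n).ne'
  have hk : (k ! : ℝ) ≠ 0 := by exact_mod_cast k.factorial_ne_zero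
  simp only [mul_pow, div_pow, pow_add, ← pow_mul, mul_comm k]
  field_simp

end Shape

/-- The difference quotient at 0 of h ↦ exp(λh), taken at h = 1/√n. -/
lemma tendsto_exp_sub_one_mul (lam : ℝ) :
    Tendsto (fun n : ℕ => √(n : ℝ) * (Real.exp (lam / √(n : ℝ)) - 1)) atTop (𝓝 lam) := by
  have hd : HasDerivAt (fun h : ℝ => Real.exp (lam * h)) lam 0 := by
    have := ((hasDerivAt_id (0 : ℝ)).const_mul lam).exp
    simpa using this
  have h0 : Tendsto (fun n : ℕ => (√(n : ℝ))⁻¹) atTop (𝓝[≠] 0) := by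
    refine tendsto_nhdsWithin_of_tendsto_nhds_of_eventually_within _
      tendsto_sqrt_natCast.inv_tendsto_atTop ?_
    filter_upwards [eventually_gt_atTop 0] with n hn
    have : 0 < √(n : ℝ) := Real.sqrt_pos.2 (Nat.cast_pos.2 hn)
    exact inv_ne_zero this.ne'
  have := (hasDerivAt_iff_tendsto_slope_zero.1 hd).comp h0
  refine this.congr fun n => ?_
  simp [div_eq_mul_inv]

lemma tendsto_mul_exp_sub_one_sub (lam : ℝ) :
    Tendsto (fun n : ℕ => (n : ℝ) * (Real.exp (lam / √(n : ℝ)) - 1) - lam * √(n : ℝ)) atTop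
      (𝓝 (lam ^ 2 / 2)) := by
  have hs := tendsto_sqrt_natCast
  -- The cubic Taylor remainder of `Real.exp_bound` has constant 4/(3!·3); multiplied by `n` it is
  -- still of order 1/√n.
  have h1 : Tendsto (fun n : ℕ => |lam| ^ 3 * (4 / 18) * (√(n : ℝ))⁻¹) atTop (𝓝 0) := by
    have := hs.inv_tendsto_atTop.const_mul (|lam| ^ 3 * (4 / 18))
    rwa [mul_zero] at this
  rw [tendsto_iff_dist_tendsto_zero]
  refine squeeze_zero' (Eventually.of_forall fun _ => dist_nonneg) ?_ h1
  filter_upwards [hs.eventually_ge_atTop |lam|, eventually_gt_atTop 0] with n hn hn0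
  have hn' : (0 : ℝ) < n := Nat.cast_pos.2 hn0
  have hpos : 0 < √(n : ℝ) := Real.sqrt_pos.2 hn'
  have hsq : √(n : ℝ) ^ 2 = n := Real.sq_sqrt hn'.le
  have hz : |lam / √(n : ℝ)| ≤ 1 := by
    rw [abs_div, abs_of_pos hpos]
    exact div_le_one_of_le₀ hn hpos.le
  have hb := Real.exp_bound hz (n := 3) (by norm_num)
  simp only [Finset.sum_range_succ, Finset.range_zero, Finset.sum_empty, pow_zero, pow_one,
    Nat.factorial] at hb
  norm_num at hb
  rw [Real.dist_eq]
  generalize √(n : ℝ) = r at *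
  have e : (n : ℝ) * (Real.exp (lam / r) - 1) - lam * r - lam ^ 2 / 2 =
      n * (Real.exp (lam / r) - (1 + lam / r + (lam / r) ^ 2 / 2)) := by
    rw [← hsq]
    field_simp
    ring
  rw [e, abs_mul, abs_of_pos hn']
  have hb' := mul_le_mul_of_nonneg_left hb hn'.le
  refine hb'.trans (le_of_eq ?_)
  rw [abs_div, abs_of_pos hpos]
  rw [← hsq]
  field_simp
  ring

namespace Shape

variable (S : Shape)

/-- The moment generating function of the centred count converges, for nonnegative arguments. -/
theorem tendsto_average_exp (hS : S.IsStrong) {lam : ℝ} (hlam : 0 ≤ lam) :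
    Tendsto (fun n : ℕ => (∑ M : MeandricSystem n,
      Real.exp (lam * (((shapeCount S M : ℝ) - n * S.mean) / √(n : ℝ)))) / (catalan n : ℝ) ^ 2) atTop
      (𝓝 (Real.exp (lam ^ 2 / 2 * S.var))) := by
  -- With this `u`, (1 + u)^X = exp(λX/√n). The sign of λ makes `u` nonnegative, hence a legitimate
  -- Poisson parameter.
  set u : ℕ → ℝ := fun n => Real.exp (lam / √(n : ℝ)) - 1 with hu
  have hu0 : ∀ n, 0 ≤ u n := fun n => by
    have : 0 ≤ lam / √(n : ℝ) := by positivity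
    simpa [hu] using this
  have hmean := S.mean_pos
  have hx : Tendsto (fun n : ℕ => u n * (S.mean * n) / √(n : ℝ)) atTop (𝓝 (S.mean * lam)) := by
    refine ((tendsto_exp_sub_one_mul lam).const_mul S.mean).congr fun n => ?_
    rw [hu]
    rw [show (Real.exp (lam / √(n : ℝ)) - 1) * (S.mean * n) / √(n : ℝ) =
      S.mean * ((n / √(n : ℝ)) * (Real.exp (lam / √(n : ℝ)) - 1)) by ring, Real.div_sqrt]
  have h1 := tendsto_binomialMoment_series (d := 2 * S.halfLength) (p := S.upDrop) (q := S.lowDrop)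
    (by have := S.halfLength_pos; omega) (x := fun n => u n * (S.mean * n))
    (fun n => by have := hu0 n; positivity) hx
  have h2 := (Real.continuous_exp.tendsto _).comp
    ((tendsto_mul_exp_sub_one_sub lam).const_mul S.mean)
  have h3 := h2.mul h1
  rw [← Real.exp_add] at h3
  have e : S.mean * (lam ^ 2 / 2) +
      -((2 * ((2 * S.halfLength : ℕ) : ℝ) - 1) / 4 * (S.mean * lam) ^ 2) = lam ^ 2 / 2 * S.var := by
    rw [var]
    push_cast
    ring
  rw [e] at h3
  refine h3.congr fun n => ?_
  rw [← S.sum_pow_shapeCount hS n (u n), Function.comp, mul_div_assoc', mul_div_assoc', Finset.mul_sum,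
    Finset.mul_sum]
  congr 1
  refine Finset.sum_congr rfl fun M _ => ?_
  rw [hu, add_sub_cancel, ← Real.exp_nat_mul, ← Real.exp_add, ← Real.exp_add]
  congr 1
  have : (n : ℝ) / √(n : ℝ) = √(n : ℝ) := Real.div_sqrt
  rw [sub_div, mul_sub, mul_div_right_comm (n : ℝ), this]
  ring

/-- By Cauchy–Schwarz the square of the average of exp(Y) is at most the average of exp(2Y). In the
limit exp(σ²) ≤ exp(2σ²), so σ² ≥ 0, and zero is excluded by arithmetic. -/
lemma var_pos (hS : S.IsStrong) : 0 < S.var := by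
  refine lt_of_le_of_ne ?_ S.var_ne_zero.symm
  have h1 := (S.tendsto_average_exp hS zero_le_one).pow 2
  have h2 := S.tendsto_average_exp hS (zero_le_two)
  have h3 := le_of_tendsto_of_tendsto' h1 h2 fun n => ?_
  · rw [← Real.exp_nat_mul, Real.exp_le_exp] at h3
    norm_num at h3
    linarith
  · have hc : (0 : ℝ) < (catalan n : ℝ) ^ 2 := by
      have := catalan_pos n
      positivity
    rw [div_pow, div_le_div_iff₀ (by positivity) hc]
    have h4 := sq_sum_le_card_mul_sum_sq (s := (Finset.univ : Finset (MeandricSystem n)))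
      (f := fun M => Real.exp (1 * (((shapeCount S M : ℝ) - n * S.mean) / √(n : ℝ))))
    rw [Finset.card_univ, card_meandricSystem] at h4
    have h5 : ∀ M : MeandricSystem n,
        Real.exp (1 * (((shapeCount S M : ℝ) - n * S.mean) / √(n : ℝ))) ^ 2 =
          Real.exp (2 * (((shapeCount S M : ℝ) - n * S.mean) / √(n : ℝ))) := by
      intro M
      rw [← Real.exp_nat_mul]
      norm_num
    simp only [h5] at h4
    push_cast at h4
    nlinarith

lemma stdDev_pos (hS : S.IsStrong) : 0 < S.stdDev := by
  rw [stdDev_eq_sqrt_var]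
  exact Real.sqrt_pos.2 (S.var_pos hS)

lemma integral_uniformMeandric {n : ℕ} (f : MeandricSystem n → ℝ) :
    ∫ M, f M ∂(uniformMeandric n) = (∑ M, f M) / (catalan n : ℝ) ^ 2 := by
  rw [uniformMeandric, PMF.integral_eq_sum]
  simp only [PMF.uniformOfFintype_apply, card_meandricSystem, smul_eq_mul, ENNReal.toReal_inv]
  rw [← Finset.mul_sum, div_eq_inv_mul]
  simp

/-- The moment generating functions of the normalized counts converge to that of the standard normal
law, for nonnegative arguments. -/
theorem tendsto_mgf_normalized (hS : S.IsStrong) {lam : ℝ} (hlam : 0 ≤ lam) :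
    Tendsto (fun n : ℕ => ∫ M, Real.exp (lam * (((shapeCount S M : ℝ) - n * S.mean) /
      (S.stdDev * √(n : ℝ)))) ∂(uniformMeandric n)) atTop (𝓝 (Real.exp (lam ^ 2 / 2))) := by
  have hs := S.stdDev_pos hS
  have h := S.tendsto_average_exp hS (lam := lam / S.stdDev) (by positivity)
  have e : (lam / S.stdDev) ^ 2 / 2 * S.var = lam ^ 2 / 2 := by
    have hv := S.var_pos hS
    rw [stdDev_eq_sqrt_var, div_pow, Real.sq_sqrt hv.le]
    field_simp
  rw [e] at h
  refine h.congr fun n => ?_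
  rw [integral_uniformMeandric]
  congr 1
  refine Finset.sum_congr rfl fun M _ => ?_
  congr 1
  rw [div_mul_div_comm, mul_div_assoc]

end Shape

/-! ### Weak convergence from one-sided moment generating functions -/

open scoped BoundedContinuousFunction

/-- Controls both tails by exponentials with nonnegative exponents only. For x < -r, exp(x/r) drops
below 1/e; for x > 0, one half of the last term pays for exp(x/r) - 1 and the other half for the
indicator. After integration the right side is O(1/r), because the moment generating function at 1/r
is asymptotically at least 1. -/
lemma tail_le_exp {r x : ℝ} (hr : 1 ≤ r) :
    {x : ℝ | r < ‖x‖}.indicator (fun _ => 1 - Real.exp (-1)) x ≤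
      1 - Real.exp (r⁻¹ * x) + 2 / r * Real.exp (2 * x) := by
  have hr0 : 0 < r := by linarith
  have he : 0 < Real.exp (-1) := Real.exp_pos _
  have h2 : 0 < 1 / r * Real.exp (2 * x) := by positivity
  have e2 : 2 / r * Real.exp (2 * x) = 1 / r * Real.exp (2 * x) + 1 / r * Real.exp (2 * x) := by ring
  rcases le_or_gt x 0 with hx | hx
  · have h3 : Real.exp (r⁻¹ * x) ≤ 1 := Real.exp_le_one_iff.2 (mul_nonpos_of_nonneg_of_nonpos
      (by positivity) hx)
    by_cases h : r < ‖x‖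
    · rw [Set.indicator_of_mem (show x ∈ {x : ℝ | r < ‖x‖} from h)]
      rw [Real.norm_eq_abs, abs_of_nonpos hx] at h
      have h4 : Real.exp (r⁻¹ * x) ≤ Real.exp (-1) := by
        rw [Real.exp_le_exp, ← div_eq_inv_mul, div_le_iff₀ hr0]
        linarith
      linarith
    · rw [Set.indicator_of_notMem (show x ∉ {x : ℝ | r < ‖x‖} from h)]
      linarith
  · have h3 : Real.exp (r⁻¹ * x) - 1 ≤ 1 / r * Real.exp (2 * x) := by
      have h4 : Real.exp (r⁻¹ * x) - 1 ≤ r⁻¹ * x * Real.exp (r⁻¹ * x) := by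
        have := Real.add_one_le_exp (-(r⁻¹ * x))
        rw [Real.exp_neg] at this
        have h5 := Real.exp_pos (r⁻¹ * x)
        have h6 := mul_le_mul_of_nonneg_right this h5.le
        rw [inv_mul_cancel₀ h5.ne'] at h6
        linarith
      have h7 : r⁻¹ * x ≤ x := by
        have : r⁻¹ ≤ 1 := inv_le_one_of_one_le₀ hr
        nlinarith
      have h8 : x * Real.exp (r⁻¹ * x) ≤ Real.exp (2 * x) := by
        rw [two_mul, Real.exp_add]
        have := Real.add_one_le_exp x
        exact mul_le_mul (by linarith) (Real.exp_le_exp.2 h7) (Real.exp_pos _).le (Real.exp_pos _).le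
      calc _ ≤ r⁻¹ * (x * Real.exp (r⁻¹ * x)) := by linarith
        _ ≤ _ := by
          rw [one_div]
          exact mul_le_mul_of_nonneg_left h8 (by positivity)
    by_cases h : r < ‖x‖
    · rw [Set.indicator_of_mem (show x ∈ {x : ℝ | r < ‖x‖} from h)]
      rw [Real.norm_eq_abs, abs_of_pos hx] at h
      have h4 : 1 ≤ 1 / r * Real.exp (2 * x) := by
        rw [one_div, ← div_eq_inv_mul, one_le_div hr0]
        linarith [Real.add_one_le_exp (2 * x)]
      linarith
    · rw [Set.indicator_of_notMem (show x ∉ {x : ℝ | r < ‖x‖} from h)]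
      linarith

section OneSided

variable {P : ℕ → ProbabilityMeasure ℝ}

/-- Probability measures whose moment generating functions converge to that of the standard normal
law on `[0, ∞)` are tight. -/
lemma isTightMeasureSet_of_tendsto_mgf
    (hint : ∀ n, ∀ t : ℝ, 0 ≤ t → Integrable (fun x => Real.exp (t * x)) (P n : Measure ℝ))
    (h : ∀ t : ℝ, 0 ≤ t → Tendsto (fun n => ∫ x, Real.exp (t * x) ∂(P n : Measure ℝ)) atTop
      (𝓝 (Real.exp (t ^ 2 / 2)))) :
    IsTightMeasureSet (Set.range fun n => (P n : Measure ℝ)) := by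
  apply isTightMeasureSet_range_of_tendsto_limsup_measure_norm_gt
  set c : ℝ := 1 - Real.exp (-1) with hc
  have hc0 : 0 < c := by
    have : Real.exp (-1) < 1 := by rw [← Real.exp_zero, Real.exp_lt_exp]; norm_num
    linarith
  have hlim : Tendsto (fun r : ℝ => ENNReal.ofReal ((2 * Real.exp 2 + 1) / c * r⁻¹)) atTop (𝓝 0) := by
    rw [← ENNReal.ofReal_zero]
    refine ENNReal.tendsto_ofReal ?_
    have := tendsto_inv_atTop_zero (𝕜 := ℝ) |>.const_mul ((2 * Real.exp 2 + 1) / c)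
    rwa [mul_zero] at this
  refine tendsto_of_tendsto_of_tendsto_of_le_of_le' tendsto_const_nhds hlim
    (Eventually.of_forall fun _ => zero_le) ?_
  filter_upwards [eventually_ge_atTop 1] with r hr
  have hr0 : 0 < r := by linarith
  refine limsup_le_of_le (by isBoundedDefault) ?_
  have t1 := ((h r⁻¹ (by positivity)).const_sub 1).add ((h 2 (by norm_num)).const_mul (2 / r))
  have hlt : 1 - Real.exp (r⁻¹ ^ 2 / 2) + 2 / r * Real.exp (2 ^ 2 / 2) <
      (2 * Real.exp 2 + 1) * r⁻¹ := by
    have : 1 ≤ Real.exp (r⁻¹ ^ 2 / 2) := Real.one_le_exp (by positivity)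
    have h0 : 0 < r⁻¹ := by positivity
    rw [show ((2 : ℝ) ^ 2 / 2) = 2 by norm_num, div_eq_mul_inv 2 r, add_mul, mul_right_comm 2 r⁻¹]
    linarith
  filter_upwards [t1.eventually_lt_const hlt] with n hn
  have hmeas : MeasurableSet {x : ℝ | r < ‖x‖} := measurableSet_lt measurable_const measurable_norm
  have key : c * (P n : Measure ℝ).real {x : ℝ | r < ‖x‖} ≤
      1 - ∫ x, Real.exp (r⁻¹ * x) ∂(P n : Measure ℝ) +
        2 / r * ∫ x, Real.exp (2 * x) ∂(P n : Measure ℝ) := by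
    have i1 := hint n r⁻¹ (by positivity)
    have i2 := (hint n 2 (by norm_num)).const_mul (2 / r)
    have e : ∫ x, (1 - Real.exp (r⁻¹ * x) + 2 / r * Real.exp (2 * x)) ∂(P n : Measure ℝ) =
        1 - ∫ x, Real.exp (r⁻¹ * x) ∂(P n : Measure ℝ) +
        2 / r * ∫ x, Real.exp (2 * x) ∂(P n : Measure ℝ) := by
      have i0 : Integrable (fun _ : ℝ => (1 : ℝ)) (P n : Measure ℝ) := integrable_const _
      have i3 : Integrable (fun x => 1 - Real.exp (r⁻¹ * x)) (P n : Measure ℝ) := i0.sub i1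
      rw [integral_add i3 i2, integral_sub i0 i1, integral_const_mul]
      simp
    rw [← e, mul_comm, ← smul_eq_mul, ← integral_indicator_const _ hmeas]
    exact integral_mono ((integrable_const _).indicator hmeas)
      (((integrable_const _).sub i1).add i2) fun x => tail_le_exp hr
  rw [← ofReal_measureReal]
  refine ENNReal.ofReal_le_ofReal ?_
  rw [div_mul_eq_mul_div, le_div_iff₀ hc0, mul_comm]
  exact key.trans hn.le

/-- The exponential moments converge along weakly convergent ultrafilters. -/
lemma mgf_of_ultrafilter_limit
    (hint : ∀ n, ∀ t : ℝ, 0 ≤ t → Integrable (fun x => Real.exp (t * x)) (P n : Measure ℝ))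
    (h : ∀ t : ℝ, 0 ≤ t → Tendsto (fun n => ∫ x, Real.exp (t * x) ∂(P n : Measure ℝ)) atTop
      (𝓝 (Real.exp (t ^ 2 / 2))))
    {U : Ultrafilter ℕ} (hU : (U : Filter ℕ) ≤ atTop) {Q : ProbabilityMeasure ℝ}
    (hQ : Tendsto P U (𝓝 Q)) {t : ℝ} (ht : 0 ≤ t) :
    Integrable (fun x => Real.exp (t * x)) (Q : Measure ℝ) ∧
      ∫ x, Real.exp (t * x) ∂(Q : Measure ℝ) = Real.exp (t ^ 2 / 2) := by
  -- Weak convergence only tests bounded functions, so the exponential is truncated at height `m +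
  -- 1`.
  let g : ℕ → (ℝ →ᵇ ℝ) := fun m => BoundedContinuousFunction.ofNormedAddCommGroup
    (fun x => min (Real.exp (t * x)) (m + 1)) (by fun_prop) (m + 1) fun x => by
      rw [Real.norm_eq_abs, abs_of_nonneg (le_min (Real.exp_pos _).le (by positivity))]
      exact min_le_right _ _
  have hg : ∀ m x, g m x = min (Real.exp (t * x)) (m + 1) := fun m x => rfl
  have hg0 : ∀ m x, 0 ≤ g m x := fun m x => le_min (Real.exp_pos _).le (by positivity)
  have hgt : ∀ m, Tendsto (fun n => ∫ x, g m x ∂(P n : Measure ℝ)) U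
      (𝓝 (∫ x, g m x ∂(Q : Measure ℝ))) := fun m =>
    ProbabilityMeasure.tendsto_iff_forall_integral_tendsto.1 hQ (g m)
  have hup : ∀ m, ∫ x, g m x ∂(Q : Measure ℝ) ≤ Real.exp (t ^ 2 / 2) := fun m =>
    le_of_tendsto_of_tendsto' (hgt m) ((h t ht).mono_left hU) fun n =>
      integral_mono ((g m).integrable _) (hint n t ht) fun x => min_le_left _ _
  -- From y - y²/M ≤ min(y, M) with M = m + 1: the truncation loss is controlled by the moment
  -- generating function at `2 * t`, uniformly in the limit.
  have hlow : ∀ m : ℕ, Real.exp (t ^ 2 / 2) - 1 / ((m : ℝ) + 1) * Real.exp ((2 * t) ^ 2 / 2) ≤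
      ∫ x, g m x ∂(Q : Measure ℝ) := by
    intro m
    have hm : (0 : ℝ) < m + 1 := by positivity
    refine le_of_tendsto_of_tendsto' (((h t ht).sub ((h (2 * t) (by positivity)).const_mul
      (1 / ((m : ℝ) + 1)))).mono_left hU) (hgt m) fun n => ?_
    have i2 := (hint n (2 * t) (by positivity)).const_mul (1 / ((m : ℝ) + 1))
    rw [← integral_const_mul, ← integral_sub (hint n t ht) i2]
    refine integral_mono ((hint n t ht).sub i2) ((g m).integrable _) fun x => ?_
    have hx := Real.exp_pos (t * x)
    have e : Real.exp (2 * t * x) = Real.exp (t * x) ^ 2 := by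
      rw [← Real.exp_nat_mul]
      push_cast
      ring_nf
    simp only [hg, e]
    refine le_min ?_ ?_
    · have : 0 ≤ 1 / ((m : ℝ) + 1) * Real.exp (t * x) ^ 2 := by positivity
      linarith
    · rw [sub_le_iff_le_add, one_div, ← div_eq_inv_mul, ← sub_le_iff_le_add', le_div_iff₀ hm]
      nlinarith [sq_nonneg (Real.exp (t * x) - (m + 1))]
  have hptw : ∀ x : ℝ, ∀ᶠ m : ℕ in atTop, g m x = Real.exp (t * x) := by
    intro x
    obtain ⟨N, hN⟩ := exists_nat_ge (Real.exp (t * x))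
    filter_upwards [eventually_ge_atTop N] with m hm
    rw [hg, min_eq_left]
    have : (N : ℝ) ≤ m := by exact_mod_cast hm
    linarith
  have hInt : Integrable (fun x => Real.exp (t * x)) (Q : Measure ℝ) := by
    refine ⟨by fun_prop, ?_⟩
    rw [hasFiniteIntegral_iff_ofReal (Eventually.of_forall fun x => (Real.exp_pos _).le)]
    -- Fatou's lemma along the truncations gives integrability under the limit law.
    have e : ∀ x : ℝ, ENNReal.ofReal (Real.exp (t * x)) =
        liminf (fun m : ℕ => ENNReal.ofReal (g m x)) atTop := by
      intro x
      refine (Tendsto.liminf_eq ?_).symm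
      exact tendsto_const_nhds.congr' ((hptw x).mono fun m hm => by
        simp only [hm])
    simp only [e]
    refine (lintegral_liminf_le fun m => (g m).continuous.measurable.ennreal_ofReal).trans_lt ?_
    refine lt_of_le_of_lt (liminf_le_of_le (by isBoundedDefault) (a := ENNReal.ofReal
      (Real.exp (t ^ 2 / 2))) fun b hb => ?_) ENNReal.ofReal_lt_top
    obtain ⟨m, hm⟩ := hb.exists
    refine hm.trans ?_
    rw [← ofReal_integral_eq_lintegral_ofReal ((g m).integrable _) (Eventually.of_forall (hg0 m))]
    exact ENNReal.ofReal_le_ofReal (hup m)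
  refine ⟨hInt, le_antisymm ?_ ?_⟩
  · have := tendsto_integral_of_dominated_convergence (μ := (Q : Measure ℝ)) (F := fun m x => g m x)
      (f := fun x => Real.exp (t * x)) (fun x => Real.exp (t * x))
      (fun m => (g m).continuous.aestronglyMeasurable) hInt
      (fun m => Eventually.of_forall fun x => by
        rw [Real.norm_eq_abs, abs_of_nonneg (hg0 m x)]
        exact min_le_left _ _)
      (Eventually.of_forall fun x => tendsto_const_nhds.congr' ((hptw x).mono fun m hm => hm.symm))
    exact le_of_tendsto' this hup
  · have t1 : Tendsto (fun m : ℕ => Real.exp (t ^ 2 / 2) - 1 / ((m : ℝ) + 1) *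
        Real.exp ((2 * t) ^ 2 / 2)) atTop (𝓝 (Real.exp (t ^ 2 / 2) - 0 * Real.exp ((2 * t) ^ 2 / 2))) :=
      tendsto_const_nhds.sub (tendsto_one_div_add_atTop_nhds_zero_nat.mul_const _)
    rw [zero_mul, sub_zero] at t1
    exact le_of_tendsto' t1 fun m => (hlow m).trans
      (integral_mono ((g m).integrable _) hInt fun x => min_le_left _ _)

/-- A probability measure with the moment generating function of the standard normal law on `[0, ∞)`
is the standard normal law. -/
lemma eq_gaussianReal_of_mgf {Q : Measure ℝ} [IsProbabilityMeasure Q]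
    (hint : ∀ t : ℝ, 0 ≤ t → Integrable (fun x => Real.exp (t * x)) Q)
    (h : ∀ t : ℝ, 0 ≤ t → ∫ x, Real.exp (t * x) ∂Q = Real.exp (t ^ 2 / 2)) :
    Q = gaussianReal 0 1 := by
  have hsub : {z : ℂ | 0 < z.re} ⊆ {z : ℂ | z.re ∈ interior (integrableExpSet id Q)} := by
    intro z hz
    refine mem_interior.2 ⟨Set.Ioi 0, fun t ht => hint t (le_of_lt ht), isOpen_Ioi, hz⟩
  have han : AnalyticOnNhd ℂ (complexMGF id Q) {z : ℂ | 0 < z.re} :=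
    analyticOnNhd_complexMGF.mono hsub
  have han2 : AnalyticOnNhd ℂ (fun z : ℂ => Complex.exp (z ^ 2 / 2)) {z : ℂ | 0 < z.re} := by
    apply DifferentiableOn.analyticOnNhd
    · fun_prop
    · exact isOpen_lt continuous_const Complex.continuous_re
  have hreal : ∀ t : ℝ, 0 ≤ t → complexMGF id Q t = Complex.exp ((t : ℂ) ^ 2 / 2) := by
    intro t ht
    rw [complexMGF_ofReal, mgf]
    simp only [id]
    rw [h t ht]
    push_cast
    rfl
  have hEq : Set.EqOn (complexMGF id Q) (fun z : ℂ => Complex.exp (z ^ 2 / 2)) {z : ℂ | 0 < z.re} := by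
    refine han.eqOn_of_preconnected_of_frequently_eq han2
      (convex_halfSpace_re_gt 0).isPreconnected (z₀ := 1) (by simp) ?_
    -- Agreement at real points accumulating at 1 suffices for the identity theorem on the connected
    -- right half-plane.
    have hseq : Tendsto (fun n : ℕ => ((1 + 1 / ((n : ℝ) + 1) : ℝ) : ℂ)) atTop (𝓝[≠] 1) := by
      refine tendsto_nhdsWithin_of_tendsto_nhds_of_eventually_within _ ?_
        (Eventually.of_forall fun n => ?_)
      · have := (tendsto_one_div_add_atTop_nhds_zero_nat (𝕜 := ℝ)).const_add 1
        rw [add_zero] at this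
        exact_mod_cast (Complex.continuous_ofReal.tendsto _).comp this
      · have : (1 : ℝ) / ((n : ℝ) + 1) ≠ 0 := by positivity
        simp only [Set.mem_compl_iff, Set.mem_singleton_iff]
        intro h
        apply this
        have h' : (1 + 1 / ((n : ℝ) + 1) : ℝ) = 1 := by exact_mod_cast h
        linarith
    exact hseq.frequently (Frequently.of_forall fun n => hreal _ (by positivity))
  have hchar : ∀ t : ℝ, charFun Q t = charFun (gaussianReal 0 1) t := by
    intro t
    rw [← complexMGF_id_mul_I, ← complexMGF_id_mul_I, complexMGF_id_gaussianReal]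
    -- The imaginary axis is only the boundary of the domain of analyticity, so it is approached
    -- from the right, with 1 + exp(x) as dominating function.
    have hε : Tendsto (fun n : ℕ => (1 : ℝ) / ((n : ℝ) + 1)) atTop (𝓝 0) :=
      tendsto_one_div_add_atTop_nhds_zero_nat
    have hz : Tendsto (fun n : ℕ => (((1 : ℝ) / ((n : ℝ) + 1) : ℝ) : ℂ) + t * Complex.I) atTop
        (𝓝 (t * Complex.I)) := by
      have := ((Complex.continuous_ofReal.tendsto _).comp hε).add_const (t * Complex.I)
      simpa using this
    have l1 : Tendsto (fun n : ℕ => complexMGF id Q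
        ((((1 : ℝ) / ((n : ℝ) + 1) : ℝ) : ℂ) + t * Complex.I)) atTop
        (𝓝 (complexMGF id Q (t * Complex.I))) := by
      refine tendsto_integral_of_dominated_convergence (fun x => 1 + Real.exp (1 * x))
        (fun n => by fun_prop) ((integrable_const _).add (hint 1 zero_le_one))
        (fun n => Eventually.of_forall fun x => ?_) (Eventually.of_forall fun x => ?_)
      · rw [Complex.norm_exp]
        have hn0 : (0 : ℝ) ≤ 1 / ((n : ℝ) + 1) := by positivity
        have hn1 : (1 : ℝ) / ((n : ℝ) + 1) ≤ 1 := by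
          rw [div_le_one (by positivity)]
          linarith [(Nat.cast_nonneg n : (0 : ℝ) ≤ n)]
        have e : (((((1 : ℝ) / ((n : ℝ) + 1) : ℝ) : ℂ) + t * Complex.I) * (id x : ℝ)).re =
            1 / ((n : ℝ) + 1) * x := by
          simp only [id, Complex.add_re, Complex.ofReal_re, Complex.mul_re,
            Complex.I_re, Complex.I_im, Complex.ofReal_im]
          ring
        rw [e]
        rcases le_total x 0 with hx | hx
        · have : Real.exp (1 / ((n : ℝ) + 1) * x) ≤ 1 :=
            Real.exp_le_one_iff.2 (mul_nonpos_of_nonneg_of_nonpos hn0 hx)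
          linarith [Real.exp_pos (1 * x)]
        · have : Real.exp (1 / ((n : ℝ) + 1) * x) ≤ Real.exp (1 * x) :=
            Real.exp_le_exp.2 (mul_le_mul_of_nonneg_right hn1 hx)
          linarith
      · exact (Complex.continuous_exp.tendsto _).comp (hz.mul_const _)
    have l2 : Tendsto (fun n : ℕ => complexMGF id Q
        ((((1 : ℝ) / ((n : ℝ) + 1) : ℝ) : ℂ) + t * Complex.I)) atTop
        (𝓝 (Complex.exp ((t * Complex.I) ^ 2 / 2))) := by
      have c : Continuous fun z : ℂ => Complex.exp (z ^ 2 / 2) := by fun_prop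
      refine ((c.tendsto _).comp hz).congr fun n => ?_
      refine (hEq ?_).symm
      have : (0 : ℝ) < 1 / ((n : ℝ) + 1) := by positivity
      show 0 < Complex.re _
      simp only [Complex.add_re, Complex.ofReal_re, Complex.mul_re, Complex.I_re, Complex.I_im,
        Complex.ofReal_im]
      linarith
    rw [tendsto_nhds_unique l1 l2]
    congr 1
    push_cast
    ring
  exact Measure.ext_of_charFun (funext hchar)

/-- Convergence of the moment generating functions on `[0, ∞)` to that of the standard normal law
implies weak convergence. -/
theorem tendsto_gaussianReal_of_tendsto_mgf
    (hint : ∀ n, ∀ t : ℝ, 0 ≤ t → Integrable (fun x => Real.exp (t * x)) (P n : Measure ℝ))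
    (h : ∀ t : ℝ, 0 ≤ t → Tendsto (fun n => ∫ x, Real.exp (t * x) ∂(P n : Measure ℝ)) atTop
      (𝓝 (Real.exp (t ^ 2 / 2)))) :
    Tendsto P atTop (𝓝 (⟨gaussianReal 0 1, inferInstance⟩ : ProbabilityMeasure ℝ)) := by
  have hcomp : IsCompact (closure (Set.range P)) := by
    apply isCompact_closure_of_isTightMeasureSet
    convert isTightMeasureSet_of_tendsto_mgf hint h using 1
    ext μ
    simp
  -- By tightness every ultrafilter above `atTop` has a limit law, and each such limit is the
  -- Gaussian; hence the whole sequence converges.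
  refine (tendsto_iff_ultrafilter _ _ _).2 fun U hU => ?_
  obtain ⟨Q, -, hQ : Tendsto _ _ _⟩ := hcomp.ultrafilter_le_nhds (U.map P)
    (.trans (by simp) (monotone_principal subset_closure))
  have hQ' : Tendsto P U (𝓝 Q) := hQ
  have e : (Q : Measure ℝ) = gaussianReal 0 1 := eq_gaussianReal_of_mgf
    (fun t ht => (mgf_of_ultrafilter_limit hint h hU hQ' ht).1)
    (fun t ht => (mgf_of_ultrafilter_limit hint h hU hQ' ht).2)
  have : Q = ⟨gaussianReal 0 1, inferInstance⟩ := Subtype.ext e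
  rw [← this]
  exact hQ'

end OneSided

/-! ### The central limit theorem -/

theorem theorem4p4 (S : Shape) (hS : S.IsStrong) :
    0 < S.mean ∧ 0 < S.stdDev ∧
      TendstoInDistribution
        (fun (n : ℕ) (M : MeandricSystem n) =>
          ((shapeCount S M : ℝ) - n * S.mean) / (S.stdDev * √(n : ℝ)))
        atTop (id : ℝ → ℝ) uniformMeandric (gaussianReal 0 1) := by
  have hmeas : ∀ n : ℕ, Measurable (fun M : MeandricSystem n =>
      ((shapeCount S M : ℝ) - n * S.mean) / (S.stdDev * √(n : ℝ))) := fun n => measurable_from_top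
  refine ⟨S.mean_pos, S.stdDev_pos hS, ⟨fun n => (hmeas n).aemeasurable, aemeasurable_id, ?_⟩⟩
  have key := tendsto_gaussianReal_of_tendsto_mgf (P := fun n =>
    ⟨(uniformMeandric n).map (fun M : MeandricSystem n =>
      ((shapeCount S M : ℝ) - n * S.mean) / (S.stdDev * √(n : ℝ))),
      Measure.isProbabilityMeasure_map (hmeas n).aemeasurable⟩)
    (fun n t _ => by
      refine (integrable_map_measure (by fun_prop) (hmeas n).aemeasurable).2 ?_
      exact Integrable.of_finite)
    (fun t ht => by
      refine (S.tendsto_mgf_normalized hS ht).congr fun n => ?_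
      exact (integral_map (f := fun x : ℝ => Real.exp (t * x)) (hmeas n).aemeasurable
        (by fun_prop)).symm)
  simpa only [Measure.map_id] using key
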